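/- Let $M$ be a smooth real supermanifold of dimension $n|m$ with structure sheaf $\mathcal O$ (parities are denoted by tildes). Let $\{\ ,\ \}$ be an odd Poisson (Schouten) structure on $M$, i.e. an $\mathbb R$-bilinear bracket on the sheaf $\mathcal O$, compatible with restrictions, such that for homogeneous $f,g,h$ the parity of $\{f,g\}$ is $\tilde f+\tilde g+1$ and $$\{f,g\}=-(-1)^{(\tilde f+1)(\tilde g+1)}\{g,f\},\qquad \{f,gh\}=\{f,g\}h+(-1)^{(\tilde f+1)\tilde g}g\{f,h\},$$ $$\{f,\{g,h\}\}=\{\{f,g\},h\}+(-1)^{(\tilde f+1)(\tilde g+1)}\{g,\{f,h\}\}.$$ Let $\boldsymbol\rho$ be a non-degenerate volume form on $M$: in every chart with coordinates $x=(x^a)$ it is $\boldsymbol\rho=\rho\,Dx$ with $\rho$ even and invertible, where $Dx'=\operatorname{Ber}(\partial x'/\partial x)\,Dx$ under a change of coordinates. For a homogeneous function $f$ let $X_f:=(-1)^{\tilde f+1}\{f,\ \}$ be its Hamiltonian vector field, and let $$\Delta_{\boldsymbol\rho}f:=\operatorname{div}_{\boldsymbol\rho}X_f,\qquad \operatorname{div}_{\boldsymbol\rho}X=\frac{\mathcal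 L_X\boldsymbol\rho}{\boldsymbol\rho}=\frac1\rho\sum_a(-1)^{\tilde a(\tilde X+1)}\frac{\partial(\rho X^a)}{\partial x^a}\quad\text{in every chart,}$$ extended linearly to all functions. Then $\Delta_{\boldsymbol\rho}$ is well defined (there is exactly one linear operator on functions on all open parts of $M$ with this property), and its square $\Delta_{\boldsymbol\rho}^2$ is an even vector field on $M$, i.e. a parity-preserving linear operator on $\mathcal O$, compatible with restrictions, with $\Delta_{\boldsymbol\rho}^2(fg)=(\Delta_{\boldsymbol\rho}^2f)g+f(\Delta_{\boldsymbol\rho}^2g)$. Moreover this vector field is a derivation of the odd bracket, i.e. a Poisson vector field: $$\Delta_{\boldsymbol\rho}^2\{f,g\}=\{\Delta_{\boldsymbol\rho}^2f,g\}+\{f,\Delta_{\boldsymbol\rho}^2g\}$$ for all functions $f,g$ on any open part of $M$. -/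

import Mathlib

open TopologicalSpace Opposite CategoryTheory
open scoped ContDiff

universe u

noncomputable section

namespace SuperGeometry

/-- The sign `(-1) ^ p` of a parity `p`. -/
def sgn (p : ZMod 2) : ℝ := if p = 0 then 1 else -1

/-- The Grassmann algebra on `m` odd generators. -/
abbrev Grassmann (m : ℕ) : Type := ExteriorAlgebra ℝ (Fin m → ℝ)

/-- The homogeneous part of parity `p` of the Grassmann algebra. -/
def grassmannPart (m : ℕ) (p : ZMod 2) : Submodule ℝ (Grassmann m) :=
  CliffordAlgebra.evenOdd (0 : QuadraticForm ℝ (Fin m → ℝ)) p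

/-- A sheaf of supercommutative real superalgebras on a topological space. -/
structure SuperSheaf (X : TopCat.{u}) where
  sheaf : TopCat.Sheaf (AlgCat.{u} ℝ) X
  grading : ∀ U : Opens X, ZMod 2 → Submodule ℝ (sheaf.presheaf.obj (op U))
  graded : ∀ U : Opens X, GradedAlgebra (grading U)
  map_mem : ∀ {U V : Opens X} (i : V ⟶ U) {p : ZMod 2} {f : sheaf.presheaf.obj (op U)},
    f ∈ grading U p → (sheaf.presheaf.map i.op).hom f ∈ grading V p
  supercomm : ∀ (U : Opens X) {p q : ZMod 2} {f g : sheaf.presheaf.obj (op U)},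
    f ∈ grading U p → g ∈ grading U q → g * f = sgn (p * q) • (f * g)

attribute [instance] SuperSheaf.graded

namespace SuperSheaf

variable {X : TopCat.{u}} (A : SuperSheaf X)

/-- The superalgebra of sections over an open set. -/
abbrev Sec (U : Opens X) : Type u := A.sheaf.presheaf.obj (op U)

/-- Restriction of sections. -/
def res {U V : Opens X} (h : V ≤ U) : A.Sec U →ₐ[ℝ] A.Sec V :=
  (A.sheaf.presheaf.map (homOfLE h).op).hom

theorem res_mem {U V : Opens X} (h : V ≤ U) {p : ZMod 2} {f : A.Sec U}
    (hf : f ∈ A.grading U p) : A.res h f ∈ A.grading V p :=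
  A.map_mem (homOfLE h) hf

theorem res_res {U V W : Opens X} (h : V ≤ U) (h₂ : W ≤ V) (f : A.Sec U) :
    A.res h₂ (A.res h f) = A.res (h₂.trans h) f := by
  have e : (homOfLE (h₂.trans h)).op = (homOfLE h).op ≫ (homOfLE h₂).op := rfl
  simp only [res, e, Functor.map_comp, AlgCat.hom_comp, AlgHom.comp_apply]

/-- A superchart of dimension `n|m`: an open set, a homeomorphism `e` of it onto an open subset of
`ℝⁿ`, and an isomorphism of sheaves of superalgebras `val` from the structure sheaf on this open
set onto the sheaf of smooth functions with values in the Grassmann algebra. -/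
structure Chart (n m : ℕ) where
  e : OpenPartialHomeomorph X (EuclideanSpace ℝ (Fin n))
  val : ∀ W : Opens X, (W : Set X) ⊆ e.source → (A.Sec W →ₐ[ℝ] (W → Grassmann m))
  val_res : ∀ {W W₂ : Opens X} (h : W₂ ≤ W) (hW : (W : Set X) ⊆ e.source) (f : A.Sec W)
    (x : W₂), val W₂ (fun _ hx => hW (h hx)) (A.res h f) x = val W hW f ⟨x, h x.2⟩
  val_injective : ∀ (W : Opens X) (hW : (W : Set X) ⊆ e.source),
    Function.Injective (val W hW)
  val_range : ∀ (W : Opens X) (hW : (W : Set X) ⊆ e.source) (F : W → Grassmann m),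
    F ∈ Set.range (val W hW) ↔
      ∃ G : EuclideanSpace ℝ (Fin n) → Grassmann m, (∀ x : W, F x = G (e x)) ∧
        ∀ l : Module.Dual ℝ (Grassmann m), ContDiffOn ℝ ∞ (fun y => l (G y)) (e '' W)
  val_parity : ∀ (W : Opens X) (hW : (W : Set X) ⊆ e.source) (p : ZMod 2) (f : A.Sec W),
    f ∈ A.grading W p ↔ ∀ x : W, val W hW f x ∈ grassmannPart m p

/-- Indices of the coordinates: `n` even ones and `m` odd ones. -/
abbrev Idx (n m : ℕ) : Type := Fin n ⊕ Fin m

/-- The parity of a coordinate. -/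
def par {n m : ℕ} : Idx n m → ZMod 2 := Sum.elim (fun _ => 0) (fun _ => 1)

namespace Chart

variable {A} {n m : ℕ} (c : A.Chart n m)

/-- The domain of a chart. -/
def dom : Opens X := ⟨c.e.source, c.e.open_source⟩

/-- A section over `W`, written as a function of the even coordinates with values in the Grassmann
algebra (extended by `0` outside the image of `W`). -/
def read {W : Opens X} (hW : W ≤ c.dom) (f : A.Sec W) :
    EuclideanSpace ℝ (Fin n) → Grassmann m :=
  open Classical in
  fun y => if h : c.e.symm y ∈ W then c.val W hW f ⟨c.e.symm y, h⟩ else 0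

/-- The coordinate functions of a chart. -/
def coord {W : Opens X} (hW : W ≤ c.dom) : Idx n m → A.Sec W
  | Sum.inl j => Classical.epsilon fun s =>
      ∀ x : W, c.val W hW s x = algebraMap ℝ (Grassmann m) (c.e x j)
  | Sum.inr k => Classical.epsilon fun s =>
      ∀ x : W, c.val W hW s x = ExteriorAlgebra.ι ℝ (Pi.single k 1 : Fin m → ℝ)

/-- The (left) partial derivatives in a chart. In an even coordinate the Grassmann components are
differentiated; in an odd coordinate one contracts with the corresponding covector from the left. -/
def pderiv {W : Opens X} (hW : W ≤ c.dom) : Idx n m → A.Sec W → A.Sec W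
  | Sum.inl j, f => Classical.epsilon fun s =>
      ∀ (x : W) (l : Module.Dual ℝ (Grassmann m)), l (c.val W hW s x) =
        fderiv ℝ (fun y => l (c.read hW f y)) (c.e x) (EuclideanSpace.single j 1)
  | Sum.inr k, f => Classical.epsilon fun s =>
      ∀ x : W, c.val W hW s x = CliffordAlgebra.contractLeft (Q := 0)
        (LinearMap.proj k : Module.Dual ℝ (Fin m → ℝ)) (c.val W hW f x)

theorem read_apply {W : Opens X} (hW : W ≤ c.dom) (f : A.Sec W) (x : W) :
    c.read hW f (c.e x) = c.val W hW f x := by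
  have h : c.e.symm (c.e x) = x := c.e.left_inv (hW x.2)
  simp [read, h]

theorem read_smooth {W : Opens X} (hW : W ≤ c.dom) (f : A.Sec W)
    (l : Module.Dual ℝ (Grassmann m)) :
    ContDiffOn ℝ ∞ (fun y => l (c.read hW f y)) (c.e '' W) := by
  obtain ⟨G, hG, hs⟩ := (c.val_range W hW _).1 ⟨f, rfl⟩
  refine (hs l).congr ?_
  rintro _ ⟨x, hx, rfl⟩
  have := c.read_apply hW f ⟨x, hx⟩
  simp only at this
  rw [this, hG]

theorem isOpen_image {W : Opens X} (hW : W ≤ c.dom) : IsOpen (c.e '' W) :=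
  c.e.isOpen_image_of_subset_source W.2 hW

theorem val_coord_even {W : Opens X} (hW : W ≤ c.dom) (j : Fin n) (x : W) :
    c.val W hW (c.coord hW (Sum.inl j)) x = algebraMap ℝ (Grassmann m) (c.e x j) := by
  have h : ∃ s : A.Sec W, ∀ x : W, c.val W hW s x = algebraMap ℝ (Grassmann m) (c.e x j) := by
    obtain ⟨s, hs⟩ := (c.val_range W hW (fun x => algebraMap ℝ (Grassmann m) (c.e x j))).2
      ⟨fun y => algebraMap ℝ (Grassmann m) (y j), fun _ => rfl, fun l => by
        simp only [Algebra.algebraMap_eq_smul_one, map_smul, smul_eq_mul]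
        fun_prop⟩
    exact ⟨s, fun x => congrFun hs x⟩
  exact Classical.epsilon_spec h x

theorem val_coord_odd {W : Opens X} (hW : W ≤ c.dom) (k : Fin m) (x : W) :
    c.val W hW (c.coord hW (Sum.inr k)) x =
      ExteriorAlgebra.ι ℝ (Pi.single k 1 : Fin m → ℝ) := by
  have h : ∃ s : A.Sec W, ∀ x : W, c.val W hW s x =
      ExteriorAlgebra.ι ℝ (Pi.single k 1 : Fin m → ℝ) := by
    obtain ⟨s, hs⟩ := (c.val_range W hW
      (fun _ => ExteriorAlgebra.ι ℝ (Pi.single k 1 : Fin m → ℝ))).2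
      ⟨fun _ => _, fun _ => rfl, fun l => contDiffOn_const⟩
    exact ⟨s, fun x => congrFun hs x⟩
  exact Classical.epsilon_spec h x

theorem val_pderiv_even {W : Opens X} (hW : W ≤ c.dom) (j : Fin n) (f : A.Sec W) (x : W)
    (l : Module.Dual ℝ (Grassmann m)) :
    l (c.val W hW (c.pderiv hW (Sum.inl j) f) x) =
      fderiv ℝ (fun y => l (c.read hW f y)) (c.e x) (EuclideanSpace.single j 1) := by
  have h : ∃ s : A.Sec W, ∀ (x : W) (l : Module.Dual ℝ (Grassmann m)), l (c.val W hW s x) =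
      fderiv ℝ (fun y => l (c.read hW f y)) (c.e x) (EuclideanSpace.single j 1) := by
    let b := (Pi.basisFun ℝ (Fin m)).ExteriorAlgebra
    let G : EuclideanSpace ℝ (Fin n) → Grassmann m := fun y =>
      ∑ i, fderiv ℝ (fun z => b.coord i (c.read hW f z)) y (EuclideanSpace.single j 1) • b i
    have hl : ∀ (l : Module.Dual ℝ (Grassmann m)) (y : EuclideanSpace ℝ (Fin n)),
        y ∈ c.e '' W → l (G y) =
          fderiv ℝ (fun z => l (c.read hW f z)) y (EuclideanSpace.single j 1) := by
      intro l y hy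
      have e : (fun z => l (c.read hW f z)) =
          fun z => ∑ i, b.coord i (c.read hW f z) * l (b i) := by
        funext z
        conv_lhs => rw [← b.sum_repr (c.read hW f z)]
        simp only [map_sum, map_smul, smul_eq_mul, Module.Basis.coord_apply]
      have hd : ∀ i, DifferentiableAt ℝ (fun z => b.coord i (c.read hW f z)) y := fun i =>
        ((c.read_smooth hW f (b.coord i)).differentiableOn (by simp)).differentiableAt
          ((c.isOpen_image hW).mem_nhds hy)
      rw [e, fderiv_fun_sum (fun i _ => (hd i).mul_const _)]
      simp only [G, map_sum, map_smul, smul_eq_mul, _root_.sum_apply]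
      refine Finset.sum_congr rfl fun i _ => ?_
      rw [fderiv_mul_const (hd i)]
      simp [mul_comm]
    obtain ⟨s, hs⟩ := (c.val_range W hW (fun x => G (c.e x))).2 ⟨G, fun _ => rfl, fun l => by
      refine ContDiffOn.congr ?_ (hl l)
      exact ((c.read_smooth hW f l).fderiv_of_isOpen (c.isOpen_image hW)
        (m := ∞) (by simp)).clm_apply contDiffOn_const⟩
    refine ⟨s, fun x l => ?_⟩
    rw [hs]
    exact hl l _ ⟨x, x.2, rfl⟩
  exact Classical.epsilon_spec h x l

theorem val_pderiv_odd {W : Opens X} (hW : W ≤ c.dom) (k : Fin m) (f : A.Sec W) (x : W) :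
    c.val W hW (c.pderiv hW (Sum.inr k) f) x = CliffordAlgebra.contractLeft (Q := 0)
      (LinearMap.proj k : Module.Dual ℝ (Fin m → ℝ)) (c.val W hW f x) := by
  let d : Grassmann m →ₗ[ℝ] Grassmann m := CliffordAlgebra.contractLeft (Q := 0)
    (LinearMap.proj k : Module.Dual ℝ (Fin m → ℝ))
  have h : ∃ s : A.Sec W, ∀ x : W, c.val W hW s x = d (c.val W hW f x) := by
    obtain ⟨G, hG, hs⟩ := (c.val_range W hW _).1 ⟨f, rfl⟩
    obtain ⟨s, hs⟩ := (c.val_range W hW (fun x => d (c.val W hW f x))).2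
      ⟨fun y => d (G y), fun x => by rw [hG], fun l => hs (l ∘ₗ d)⟩
    exact ⟨s, fun x => congrFun hs x⟩
  exact Classical.epsilon_spec h x

end Chart

end SuperSheaf

/-- A smooth supermanifold of dimension `n|m`. -/
structure Supermanifold (n m : ℕ) where
  space : TopCat.{u}
  t2 : T2Space space
  secondCountable : SecondCountableTopology space
  structureSheaf : SuperSheaf space
  exists_chart : ∀ x : space, ∃ c : structureSheaf.Chart n m, x ∈ c.dom

/-- The Leibniz determinant of a matrix whose entries commute. -/
def leibnizDet {R : Type*} [Ring R] {k : ℕ} (B : Matrix (Fin k) (Fin k) R) : R :=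
  ∑ s : Equiv.Perm (Fin k), Equiv.Perm.sign s • (List.ofFn fun i => B (s i) i).prod

/-- The Berezinian `det (J₀₀ - J₀₁ J₁₁⁻¹ J₁₀) · (det J₁₁)⁻¹` of an even invertible supermatrix. -/
def berezinian {R : Type*} [Ring R] {n m : ℕ}
    (J : Matrix (Fin n ⊕ Fin m) (Fin n ⊕ Fin m) R) : R :=
  leibnizDet (J.toBlocks₁₁ - J.toBlocks₁₂ * Ring.inverse J.toBlocks₂₂ * J.toBlocks₂₁) *
    Ring.inverse (leibnizDet J.toBlocks₂₂)

namespace Supermanifold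

open SuperSheaf

variable {n m : ℕ} (M : Supermanifold.{u} n m)

/-- The superalgebra of smooth functions on an open part of `M`. -/
abbrev Fn (U : Opens M.space) : Type u := M.structureSheaf.Sec U

/-- The functions of parity `p`. -/
abbrev parity (U : Opens M.space) (p : ZMod 2) : Submodule ℝ (M.Fn U) :=
  M.structureSheaf.grading U p

/-- Restriction of functions. -/
abbrev res {U V : Opens M.space} (h : V ≤ U) : M.Fn U →ₐ[ℝ] M.Fn V :=
  M.structureSheaf.res h

/-- The charts of `M`, i.e. all local coordinate systems. -/
abbrev Chart : Type u := M.structureSheaf.Chart n m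

/-- A vector field of parity `p` on the open part `U`: a derivation of the structure sheaf. -/
structure VectorField (U : Opens M.space) (p : ZMod 2) where
  toFun : ∀ W : Opens M.space, W ≤ U → (M.Fn W →ₗ[ℝ] M.Fn W)
  map_mem : ∀ (W : Opens M.space) (hW : W ≤ U) {q : ZMod 2} {f : M.Fn W},
    f ∈ M.parity W q → toFun W hW f ∈ M.parity W (p + q)
  map_res : ∀ {W W₂ : Opens M.space} (hW : W ≤ U) (h : W₂ ≤ W) (f : M.Fn W),
    toFun W₂ (h.trans hW) (M.res h f) = M.res h (toFun W hW f)
  leibniz : ∀ (W : Opens M.space) (hW : W ≤ U) {q : ZMod 2} {f : M.Fn W} (g : M.Fn W),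
    f ∈ M.parity W q →
      toFun W hW (f * g) = toFun W hW f * g + sgn (p * q) • (f * toFun W hW g)

/-- An odd Poisson (Schouten) structure: an odd Poisson bracket on the structure sheaf. -/
structure OddPoisson where
  bracket : ∀ U : Opens M.space, M.Fn U →ₗ[ℝ] M.Fn U →ₗ[ℝ] M.Fn U
  bracket_res : ∀ {U V : Opens M.space} (h : V ≤ U) (f g : M.Fn U),
    bracket V (M.res h f) (M.res h g) = M.res h (bracket U f g)
  bracket_mem : ∀ (U : Opens M.space) {p q : ZMod 2} {f g : M.Fn U},
    f ∈ M.parity U p → g ∈ M.parity U q → bracket U f g ∈ M.parity U (p + q + 1)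
  bracket_symm : ∀ (U : Opens M.space) {p q : ZMod 2} {f g : M.Fn U},
    f ∈ M.parity U p → g ∈ M.parity U q →
      bracket U f g = -(sgn ((p + 1) * (q + 1)) • bracket U g f)
  bracket_mul : ∀ (U : Opens M.space) {p q : ZMod 2} {f g : M.Fn U} (h : M.Fn U),
    f ∈ M.parity U p → g ∈ M.parity U q →
      bracket U f (g * h) = bracket U f g * h + sgn ((p + 1) * q) • (g * bracket U f h)
  bracket_jacobi : ∀ (U : Opens M.space) {p q : ZMod 2} {f g : M.Fn U} (h : M.Fn U),
    f ∈ M.parity U p → g ∈ M.parity U q →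
      bracket U f (bracket U g h) = bracket U (bracket U f g) h +
        sgn ((p + 1) * (q + 1)) • bracket U g (bracket U f h)

variable {M}

/-- A vector field of parity `p` is Poisson if it is a derivation of the odd bracket. -/
def VectorField.IsPoisson {p : ZMod 2} (Y : M.VectorField ⊤ p) (P : M.OddPoisson) : Prop :=
  ∀ (U : Opens M.space) (q : ZMod 2) (f g : M.Fn U), f ∈ M.parity U q →
    Y.toFun U le_top (P.bracket U f g) = P.bracket U (Y.toFun U le_top f) g +
      sgn (p * (q + 1)) • P.bracket U f (Y.toFun U le_top g)

/-- The Hamiltonian vector field `X_f = (-1)^(p+1) {f, · }` of a function of parity `p`. -/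
def OddPoisson.hamiltonian (P : M.OddPoisson) {U : Opens M.space} {p : ZMod 2} (f : M.Fn U)
    (hf : f ∈ M.parity U p) : M.VectorField U (p + 1) where
  toFun W hW := sgn (p + 1) • P.bracket W (M.res hW f)
  map_mem W hW q g hg := by
    have h := P.bracket_mem W (M.structureSheaf.res_mem hW hf) hg
    rw [show p + 1 + q = p + q + 1 by ring]
    exact Submodule.smul_mem _ _ h
  map_res {W W₂} hW h g := by
    rw [← M.structureSheaf.res_res hW h f]
    simp only [LinearMap.smul_apply, P.bracket_res, map_smul]
  leibniz W hW q g h hg := by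
    simp only [LinearMap.smul_apply,
      P.bracket_mul W h (M.structureSheaf.res_mem hW hf) hg, smul_add, smul_mul_assoc,
      mul_smul_comm]
    rw [smul_comm (sgn (p + 1))]

/-- The change of coordinates matrix `∂ d^b / ∂ c^a` (row `a`, column `b`) of two charts. -/
def jacobian (c d : M.Chart) : Matrix (Idx n m) (Idx n m) (M.Fn (c.dom ⊓ d.dom)) :=
  Matrix.of fun a b => c.pderiv inf_le_left a (d.coord inf_le_right b)

variable (M)

/-- A non-degenerate volume form. In each chart `c` it is `coeff c` times the coordinate volume
form, with an even invertible coefficient; coordinate volume forms are related by Berezinians. -/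
structure VolumeForm where
  coeff : ∀ c : M.Chart, M.Fn c.dom
  even : ∀ c : M.Chart, coeff c ∈ M.parity c.dom 0
  isUnit : ∀ c : M.Chart, IsUnit (coeff c)
  transition : ∀ c d : M.Chart,
    M.res (inf_le_left : c.dom ⊓ d.dom ≤ c.dom) (coeff c) =
      berezinian (jacobian c d) * M.res (inf_le_right : c.dom ⊓ d.dom ≤ d.dom) (coeff d)

variable {M}

/-- The coefficient, in the chart `c`, of the Lie derivative of a volume form along a vector field
of parity `p` on `U`: `∑ₐ (-1)^(a (p + 1)) ∂ₐ (ρ Xᵃ)`, where `Xᵃ = X xᵃ`. -/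
def VolumeForm.lieCoeff (ρ : M.VolumeForm) {U : Opens M.space} {p : ZMod 2}
    (X : M.VectorField U p) (c : M.Chart) : M.Fn (U ⊓ c.dom) :=
  ∑ a : Idx n m, sgn (par a * (p + 1)) • c.pderiv inf_le_right a
    (M.res inf_le_right (ρ.coeff c) * X.toFun (U ⊓ c.dom) inf_le_left (c.coord inf_le_right a))

/-- `h` is the divergence of `X`: the Lie derivative of `ρ` along `X` equals `h ρ`. -/
def VolumeForm.IsDivergence (ρ : M.VolumeForm) {U : Opens M.space} {p : ZMod 2}
    (X : M.VectorField U p) (h : M.Fn U) : Prop :=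
  ∀ c : M.Chart, ρ.lieCoeff X c =
    M.res inf_le_left h * M.res (inf_le_right : U ⊓ c.dom ≤ c.dom) (ρ.coeff c)

variable (M) in
/-- Linear operators on functions, given on functions on all open parts of `M`. -/
abbrev FnOperator : Type u := ∀ U : Opens M.space, M.Fn U →ₗ[ℝ] M.Fn U

/-- The defining property `Δ f = div X_f` of the odd Laplace operator (`f` homogeneous). -/
def IsOddLaplacian (P : M.OddPoisson) (ρ : M.VolumeForm) (D : M.FnOperator) : Prop :=
  ∀ (U : Opens M.space) (p : ZMod 2) (f : M.Fn U) (hf : f ∈ M.parity U p),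
    ρ.IsDivergence (P.hamiltonian f hf) (D U f)

/-- The odd Laplace operator on functions: the operator `Δ` with `Δ f = div X_f`. -/
def oddLaplacian (P : M.OddPoisson) (ρ : M.VolumeForm) : M.FnOperator :=
  Classical.epsilon (IsOddLaplacian P ρ)

end Supermanifold

end SuperGeometry

end

namespace SuperGeometry

/-! Write `Δ` for the odd Laplacian and `p` for the parity of `f`. Everything follows from two
first-order identities. (1) `Δ(fg) = Δf g + (-1)^p f Δg + 2(-1)^(p+1) {f,g}`: the field of `fg` is a
combination of `f X_g` and `g X_f`, and `div (hX) = h div X ± X(h)` yields two equal bracket terms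
(`IsLaplacian.map_mul`). (2) `Δ{f,g} = {Δf,g} + (-1)^(p+1) {f,Δg}`: by the Jacobi identity the
supercommutator `[X_f, X_g]` is the field of `{f,g}`, and `div [X,Y] = X(div Y) ∓ Y(div X)`
(`IsLaplacian.map_bracket`). By (2), `Δ` is an odd derivation of the bracket, so in `Δ²{f,g}` the
two cross terms cancel. Applying `Δ` to (1) and using (2), all terms in `Δf Δg`, `{Δf,g}` and
`{f,Δg}` cancel as well, and `Δ²` is a derivation of the product.

These computations take place in an abstract superalgebra with a `CoordSystem`, in which
superderivations are determined by their values on the coordinates. A chart provides one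
(`Chart.superDer_eq_zero`): Hadamard's lemma shows that a superderivation killing the coordinates
kills every smooth function, and the Grassmann constants are polynomials in the odd coordinates.

For `Δ` to exist globally, the divergence must not depend on the chart (`lie_berezinian_mul`). This
reduces to the statement that the coordinate fields of one chart have zero divergence for the
density `Ber J` in another, which follows from `X(Ber J) = Ber J · str(X(J) J⁻¹)`
(`berezinian_logDeriv`), proved by factoring `J` into block triangular matrices. Local Laplacians
are unique because the density is invertible and every function is a sum of homogeneous ones. Hence
they agree on overlaps and glue, and identities for `Δ²` may be checked chart by chart. -/

theorem sgn_add (p q : ZMod 2) : sgn (p + q) = sgn p * sgn q := by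
  have h : ∀ p q : ZMod 2, (p + q = 0) ↔ (p = 0 ↔ q = 0) := by decide
  unfold sgn
  by_cases hp : p = 0 <;> by_cases hq : q = 0 <;> simp [h, hp, hq]

theorem sgn_eq_or (p : ZMod 2) : sgn p = 1 ∨ sgn p = -1 := by
  unfold sgn; split_ifs <;> simp

@[simp] theorem sgn_zero : sgn 0 = 1 := by simp [sgn]

@[simp] theorem sgn_one : sgn 1 = -1 := by simp [sgn]

theorem sgn_mul_sgn_self (p : ZMod 2) : sgn p * sgn p = 1 := by
  rcases sgn_eq_or p with h | h <;> simp [h]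

/-! ### Superderivations and coordinate divergences -/

section Algebra

variable {R : Type*} [Ring R] [Algebra ℝ R]

/-- Supercommutativity of a `ZMod 2`-graded algebra. -/
structure IsSupercomm (𝒜 : ZMod 2 → Submodule ℝ R) : Prop where
  comm : ∀ {p q : ZMod 2} {f g : R}, f ∈ 𝒜 p → g ∈ 𝒜 q → g * f = sgn (p * q) • (f * g)

/-- A superderivation of parity `p` of a superalgebra. -/
structure IsSuperDer (𝒜 : ZMod 2 → Submodule ℝ R) (p : ZMod 2) (X : R →ₗ[ℝ] R) : Prop where
  mem : ∀ {q : ZMod 2} {f : R}, f ∈ 𝒜 q → X f ∈ 𝒜 (p + q)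
  leibniz : ∀ {q : ZMod 2} {f : R} (g : R), f ∈ 𝒜 q →
    X (f * g) = X f * g + sgn (p * q) • (f * X g)

/-- The supercommutator of two operators of parities `p` and `q`. -/
def superCommutator (p q : ZMod 2) (X Y : R →ₗ[ℝ] R) : R →ₗ[ℝ] R :=
  X ∘ₗ Y - sgn (p * q) • Y ∘ₗ X

theorem superCommutator_apply (p q : ZMod 2) (X Y : R →ₗ[ℝ] R) (f : R) :
    superCommutator p q X Y f = X (Y f) - sgn (p * q) • Y (X f) := rfl

variable {𝒜 : ZMod 2 → Submodule ℝ R}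

namespace IsSuperDer

variable {p q : ZMod 2} {X Y : R →ₗ[ℝ] R}

theorem map_one [GradedAlgebra 𝒜] (hX : IsSuperDer 𝒜 p X) : X 1 = 0 := by
  simpa using hX.leibniz 1 (SetLike.GradedOne.one_mem (A := 𝒜))

theorem cast (hX : IsSuperDer 𝒜 p X) (h : p = q) : IsSuperDer 𝒜 q X := h ▸ hX

theorem sub (hX : IsSuperDer 𝒜 p X) (hY : IsSuperDer 𝒜 p Y) : IsSuperDer 𝒜 p (X - Y) where
  mem hf := Submodule.sub_mem _ (hX.mem hf) (hY.mem hf)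
  leibniz g hf := by
    simp only [LinearMap.sub_apply, hX.leibniz g hf, hY.leibniz g hf, mul_sub, sub_mul, smul_sub]
    abel

theorem smul (hX : IsSuperDer 𝒜 p X) (r : ℝ) : IsSuperDer 𝒜 p (r • X) where
  mem hf := Submodule.smul_mem _ _ (hX.mem hf)
  leibniz g hf := by
    simp only [LinearMap.smul_apply, hX.leibniz g hf, mul_smul_comm, smul_mul_assoc, smul_add]
    rw [smul_comm r]

theorem sum {ι : Type*} (s : Finset ι) {X : ι → R →ₗ[ℝ] R}
    (hX : ∀ i ∈ s, IsSuperDer 𝒜 p (X i)) : IsSuperDer 𝒜 p (∑ i ∈ s, X i) where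
  mem hf := by
    rw [LinearMap.sum_apply]
    exact Submodule.sum_mem _ fun i hi => (hX i hi).mem hf
  leibniz g hf := by
    simp only [LinearMap.sum_apply, Finset.sum_mul, Finset.mul_sum, Finset.smul_sum]
    rw [← Finset.sum_add_distrib]
    exact Finset.sum_congr rfl fun i hi => (hX i hi).leibniz g hf

theorem mulLeft [GradedAlgebra 𝒜] (hc : IsSupercomm 𝒜) {h : R} (hh : h ∈ 𝒜 q)
    (hX : IsSuperDer 𝒜 p X) : IsSuperDer 𝒜 (q + p) (LinearMap.mulLeft ℝ h ∘ₗ X) where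
  mem hf := by
    rw [add_assoc]
    exact SetLike.GradedMul.mul_mem hh (hX.mem hf)
  leibniz {r f} g hf := by
    simp only [LinearMap.comp_apply, LinearMap.mulLeft_apply, hX.leibniz g hf, mul_add,
      mul_smul_comm, ← mul_assoc, add_mul, sgn_add]
    rw [hc.comm hf hh, smul_mul_assoc, smul_smul, mul_comm (sgn _), mul_comm r q]

theorem superCommutator [GradedAlgebra 𝒜] (hX : IsSuperDer 𝒜 p X) (hY : IsSuperDer 𝒜 q Y) :
    IsSuperDer 𝒜 (p + q) (superCommutator p q X Y) where
  mem {r f} hf := by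
    refine Submodule.sub_mem _ ?_ (Submodule.smul_mem _ _ ?_)
    · rw [add_assoc]; exact hX.mem (hY.mem hf)
    · rw [add_comm p, add_assoc]; exact hY.mem (hX.mem hf)
  leibniz {r f} g hf := by
    simp only [superCommutator_apply, hX.leibniz g hf, hY.leibniz g hf, map_add, map_smul,
      hX.leibniz _ (hY.mem hf), hY.leibniz _ (hX.mem hf), hX.leibniz _ hf, hY.leibniz _ hf,
      mul_add, add_mul, sgn_add, mul_comm q p]
    rcases sgn_eq_or (p * q) with h1 | h1 <;> rcases sgn_eq_or (p * r) with h2 | h2 <;>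
    rcases sgn_eq_or (q * r) with h3 | h3 <;>
    simp only [h1, h2, h3, sub_mul, mul_sub, smul_sub, smul_add, one_smul, neg_smul, neg_mul,
      mul_neg, mul_one] <;> abel

end IsSuperDer

/-- A system of `n` even and `m` odd coordinates of a superalgebra with its partial derivatives,
such that every superderivation is determined by its values on the coordinates. -/
structure CoordSystem (𝒜 : ZMod 2 → Submodule ℝ R) (n m : ℕ) where
  x : SuperSheaf.Idx n m → R
  d : SuperSheaf.Idx n m → R →ₗ[ℝ] R
  x_mem : ∀ a, x a ∈ 𝒜 (SuperSheaf.par a)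
  d_der : ∀ a, IsSuperDer 𝒜 (SuperSheaf.par a) (d a)
  d_x : ∀ a b, d a (x b) = (1 : Matrix _ _ R) a b
  der_ext : ∀ {p : ZMod 2} {X : R →ₗ[ℝ] R}, IsSuperDer 𝒜 p X → (∀ a, X (x a) = 0) → X = 0

namespace CoordSystem

open SuperSheaf

variable [GradedAlgebra 𝒜] {n m : ℕ} (C : CoordSystem 𝒜 n m) (hc : IsSupercomm 𝒜)
  {p q : ZMod 2} {X Y : R →ₗ[ℝ] R}

-- The difference of the two sides is a superderivation vanishing on all coordinates, so `der_ext`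
-- kills it.
include hc in
theorem expand (hX : IsSuperDer 𝒜 p X) (f : R) : X f = ∑ a, X (C.x a) * C.d a f := by
  have key : X - ∑ a, LinearMap.mulLeft ℝ (X (C.x a)) ∘ₗ C.d a = 0 := by
    refine C.der_ext (p := p) (hX.sub (IsSuperDer.sum _ fun a _ => ?_)) fun b => ?_
    · refine ((C.d_der a).mulLeft hc (hX.mem (C.x_mem a))).cast ?_
      rw [add_assoc, CharTwo.add_self_eq_zero, add_zero]
    · simp [C.d_x, Matrix.one_apply, -Fintype.sum_sum_type]
  have := LinearMap.congr_fun key f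
  simpa [sub_eq_zero] using this

/-- The coordinate divergence `∑ₐ (-1)^(a (p + 1)) ∂ₐ (ρ Xᵃ)` of `X` with respect to the density
`ρ`, for `X` of parity `p`. -/
def lie (p : ZMod 2) (ρ : R) (X : R →ₗ[ℝ] R) : R :=
  ∑ a, sgn (par a * (p + 1)) • C.d a (ρ * X (C.x a))

include hc in
/-- The divergence of a multiple of a derivation. -/
theorem lie_mulLeft {ρ h : R} (hρ : ρ ∈ 𝒜 0) (hh : h ∈ 𝒜 q) (hX : IsSuperDer 𝒜 p X) :
    C.lie (q + p) ρ (LinearMap.mulLeft ℝ h ∘ₗ X) =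
      h * C.lie p ρ X + sgn (q * p) • (ρ * X h) := by
  have hρh : ρ * h = h * ρ := by simpa using hc.comm hh hρ
  rw [C.expand hc hX h]
  simp only [lie, LinearMap.comp_apply, LinearMap.mulLeft_apply, ← mul_assoc, hρh, Finset.mul_sum,
    Finset.smul_sum]
  rw [← Finset.sum_add_distrib]
  refine Finset.sum_congr rfl fun a _ => ?_
  have h1 : ρ * X (C.x a) ∈ 𝒜 (p + par a) := by
    simpa using SetLike.GradedMul.mul_mem hρ (hX.mem (C.x_mem a))
  -- When `∂ₐ` falls on `h`, the resulting terms reassemble, by `expand`, into `ρ X(h)`.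
  rw [mul_assoc h ρ, (C.d_der a).leibniz _ hh, hc.comm h1 ((C.d_der a).mem hh)]
  simp only [smul_add, smul_smul, ← sgn_add, mul_smul_comm]
  rw [add_comm]
  congr 3
  · exact (by decide : ∀ a p q : ZMod 2, a * (q + p + 1) + a * q = a * (p + 1)) _ _ _
  · exact (by decide : ∀ a p q : ZMod 2, a * (q + p + 1) + (p + a) * (a + q) = q * p) _ _ _

include hc in
/-- The divergence with respect to a multiple of a density. -/
theorem lie_mul {ρ σ : R} (hρ : ρ ∈ 𝒜 0) (hσ : σ ∈ 𝒜 0) (hX : IsSuperDer 𝒜 p X) :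
    C.lie p (σ * ρ) X = σ * C.lie p ρ X + ρ * X σ := by
  have h := C.lie_mulLeft hc hρ hσ hX
  have hρσ : ρ * σ = σ * ρ := by simpa using hc.comm hσ hρ
  simp only [zero_add, zero_mul, sgn_zero, one_smul] at h
  rw [← h]
  simp only [lie, LinearMap.comp_apply, LinearMap.mulLeft_apply, ← mul_assoc, hρσ]

-- Separates the divergence of `X` for the flat density from the derivative of the density itself,
-- so that the commutator formula has to be proved only for density `1`.
include hc in
theorem lie_eq {ρ : R} (hρ : ρ ∈ 𝒜 0) (hX : IsSuperDer 𝒜 p X) :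
    C.lie p ρ X = ρ * C.lie p 1 X + X ρ := by
  simpa using C.lie_mul hc (SetLike.GradedOne.one_mem (A := 𝒜)) hρ hX

omit [GradedAlgebra 𝒜] in
theorem lie_sum {ι : Type*} (s : Finset ι) (ρ : R) (X : ι → R →ₗ[ℝ] R) :
    C.lie p ρ (∑ i ∈ s, X i) = ∑ i ∈ s, C.lie p ρ (X i) := by
  simp only [lie, LinearMap.sum_apply, Finset.mul_sum, map_sum, Finset.smul_sum]
  exact Finset.sum_comm

omit [GradedAlgebra 𝒜] in
theorem lie_add (ρ : R) (X Y : R →ₗ[ℝ] R) :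
    C.lie p ρ (X + Y) = C.lie p ρ X + C.lie p ρ Y := by
  simp only [lie, LinearMap.add_apply, mul_add, map_add, smul_add, Finset.sum_add_distrib]

omit [GradedAlgebra 𝒜] in
theorem lie_smul (ρ : R) (r : ℝ) (X : R →ₗ[ℝ] R) :
    C.lie p ρ (r • X) = r • C.lie p ρ X := by
  simp only [lie, LinearMap.smul_apply, mul_smul_comm, map_smul, Finset.smul_sum]
  exact Finset.sum_congr rfl fun _ _ => smul_comm _ _ _

theorem lie_mem {ρ : R} (hρ : ρ ∈ 𝒜 0) (hX : IsSuperDer 𝒜 p X) : C.lie p ρ X ∈ 𝒜 p := by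
  refine Submodule.sum_mem _ fun a _ => Submodule.smul_mem _ _ ?_
  have := (C.d_der a).mem (SetLike.GradedMul.mul_mem hρ (hX.mem (C.x_mem a)))
  convert this using 2
  exact (by decide : ∀ a p : ZMod 2, p = a + (0 + (p + a))) _ _

include hc in
/-- The divergence of a commutator with respect to the coordinate density. -/
theorem lie_one_superCommutator (hX : IsSuperDer 𝒜 p X) (hY : IsSuperDer 𝒜 q Y) :
    C.lie (p + q) 1 (superCommutator p q X Y) =
      X (C.lie q 1 Y) - sgn (p * q) • Y (C.lie p 1 X) := by
  -- The supercommutator of `∂ₐ` with `X` is again a superderivation, with value `∂ₐ Xᵇ` on the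
  -- `b`-th coordinate because `∂ₐ x_b` is constant; `expand` then gives it on every `f`.
  have key : ∀ {p : ZMod 2} {X : R →ₗ[ℝ] R}, IsSuperDer 𝒜 p X → ∀ a f,
      C.d a (X f) = sgn (par a * p) • X (C.d a f) + ∑ b, C.d a (X (C.x b)) * C.d b f := by
    intro p X hX a f
    have h := C.expand hc ((C.d_der a).superCommutator hX) f
    have h2 : ∀ b, SuperGeometry.superCommutator (par a) p (C.d a) X (C.x b) =
        C.d a (X (C.x b)) := by
      intro b
      rw [superCommutator_apply, C.d_x, Matrix.one_apply]
      split_ifs <;> simp [hX.map_one]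
    simp only [h2] at h
    rw [← h, superCommutator_apply]
    abel
  simp only [lie, one_mul, superCommutator_apply, map_sub, map_smul, key hX _ (Y _),
    key hY _ (X _), smul_sub, smul_add, Finset.sum_sub_distrib, Finset.sum_add_distrib, map_sum,
    Finset.smul_sum, smul_smul, ← sgn_add]
  have e1 : ∀ a p q : ZMod 2, a * (p + q + 1) + a * p = a * (q + 1) := by decide
  have e2 : ∀ a p q : ZMod 2, a * (p + q + 1) + (p * q + a * q) = p * q + a * (p + 1) := by
    decide
  simp only [e1, e2]
  -- The second-order terms give `X(div Y)` and `Y(div X)`. The remaining double sums, of type `∂ₐXᵇ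
  -- ∂_bYᵃ`, are exchanged by swapping the indices and commuting the factors, hence cancel.
  have e3 : ∑ a, ∑ b, sgn (par a * (p + q + 1)) • (C.d a (X (C.x b)) * C.d b (Y (C.x a))) =
      ∑ a, ∑ b, sgn (par a * (p + q + 1) + p * q) •
        (C.d a (Y (C.x b)) * C.d b (X (C.x a))) := by
    rw [Finset.sum_comm]
    refine Finset.sum_congr rfl fun a _ => Finset.sum_congr rfl fun b _ => ?_
    rw [hc.comm ((C.d_der a).mem (hY.mem (C.x_mem b))) ((C.d_der b).mem (hX.mem (C.x_mem a))),
      smul_smul, ← sgn_add]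
    congr 2
    exact (by decide : ∀ a b p q : ZMod 2, b * (p + q + 1) + (a + (q + b)) * (b + (p + a)) =
      a * (p + q + 1) + p * q) _ _ _ _
  rw [e3]
  abel

end CoordSystem

end Algebra

/-! ### Odd brackets and the algebra of the odd Laplacian -/

section Algebra

variable {R : Type*} [Ring R] [Algebra ℝ R] {𝒜 : ZMod 2 → Submodule ℝ R}

theorem linearMap_eq_of_homogeneous [GradedAlgebra 𝒜] {S : Type*} [AddCommGroup S] [Module ℝ S]
    {X Y : R →ₗ[ℝ] S} (h : ∀ (p : ZMod 2) (f : R), f ∈ 𝒜 p → X f = Y f) : X = Y := by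
  ext f
  induction f using DirectSum.Decomposition.inductionOn 𝒜 with
  | zero => simp
  | homogeneous f => exact h _ _ f.2
  | add f g hf hg => rw [map_add, map_add, hf, hg]

/-- Multiplication by the even `u` respects components, so `u` times the odd component of `v` is the
odd component of `1`, namely zero; cancelling `u` leaves `v` even. -/
theorem inverse_mem [GradedAlgebra 𝒜] {u v : R} (hu : u ∈ 𝒜 0) (huv : u * v = 1)
    (hvu : v * u = 1) : v ∈ 𝒜 0 := by
  have h1 : (DirectSum.decompose 𝒜 v 1 : R) = 0 := by
    have h : u * (DirectSum.decompose 𝒜 v 1 : R) = 0 := by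
      rw [← DirectSum.coe_decompose_mul_of_left_mem_zero 𝒜 hu, huv,
        DirectSum.decompose_of_mem_ne 𝒜 (SetLike.GradedOne.one_mem (A := 𝒜)) (by decide)]
    rw [← one_mul (DirectSum.decompose 𝒜 v 1 : R), ← hvu, mul_assoc, h, mul_zero]
  have h2 : v = (DirectSum.decompose 𝒜 v 0 : R) + DirectSum.decompose 𝒜 v 1 := by
    conv_lhs => rw [← (DirectSum.decompose 𝒜).symm_apply_apply v,
      ← DirectSum.sum_univ_of (DirectSum.decompose 𝒜 v)]
    rw [show (Finset.univ : Finset (ZMod 2)) = {0, 1} from rfl, Finset.sum_pair (by decide)]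
    simp [DirectSum.decompose_symm_add]
  rw [h2, h1, add_zero]
  exact SetLike.coe_mem _

theorem even_mul_comm (hc : IsSupercomm 𝒜) {p : ZMod 2} {f g : R} (hf : f ∈ 𝒜 0)
    (hg : g ∈ 𝒜 p) : f * g = g * f := by
  simpa using hc.comm hg hf

/-- An odd Poisson bracket on a superalgebra. -/
structure IsOddBracket (𝒜 : ZMod 2 → Submodule ℝ R) (B : R →ₗ[ℝ] R →ₗ[ℝ] R) : Prop where
  mem : ∀ {p q : ZMod 2} {f g : R}, f ∈ 𝒜 p → g ∈ 𝒜 q → B f g ∈ 𝒜 (p + q + 1)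
  symm : ∀ {p q : ZMod 2} {f g : R}, f ∈ 𝒜 p → g ∈ 𝒜 q →
    B f g = -(sgn ((p + 1) * (q + 1)) • B g f)
  mul : ∀ {p q : ZMod 2} {f g : R} (h : R), f ∈ 𝒜 p → g ∈ 𝒜 q →
    B f (g * h) = B f g * h + sgn ((p + 1) * q) • (g * B f h)
  jacobi : ∀ {p q : ZMod 2} {f g : R} (h : R), f ∈ 𝒜 p → g ∈ 𝒜 q →
    B f (B g h) = B (B f g) h + sgn ((p + 1) * (q + 1)) • B g (B f h)

namespace IsOddBracket

variable {B : R →ₗ[ℝ] R →ₗ[ℝ] R} (hB : IsOddBracket 𝒜 B) {p q : ZMod 2} {f g : R}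

include hB

theorem isSuperDer (hf : f ∈ 𝒜 p) : IsSuperDer 𝒜 (p + 1) (B f) where
  mem hg := by
    have := hB.mem hf hg
    rwa [add_right_comm] at this
  leibniz h hg := hB.mul h hf hg

/-- Antisymmetry carries the Leibniz rule from the second slot to the first. -/
theorem mul_left [GradedAlgebra 𝒜] (hc : IsSupercomm 𝒜) (hf : f ∈ 𝒜 p) (hg : g ∈ 𝒜 q) :
    B (f * g) =
      LinearMap.mulLeft ℝ f ∘ₗ B g + sgn (p * q) • (LinearMap.mulLeft ℝ g ∘ₗ B f) := by
  refine linearMap_eq_of_homogeneous (𝒜 := 𝒜) fun r h hh => ?_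
  simp only [LinearMap.add_apply, LinearMap.smul_apply, LinearMap.comp_apply,
    LinearMap.mulLeft_apply]
  rw [hB.symm (SetLike.GradedMul.mul_mem hf hg) hh, hB.mul g hh hf, hB.symm hh hf, hB.symm hh hg,
    neg_mul, smul_mul_assoc, hc.comm hg (hB.mem hf hh)]
  simp only [smul_add, smul_neg, mul_neg, mul_smul_comm, smul_smul, ← sgn_add, neg_add, neg_neg]
  rw [add_comm]
  have e1 : ∀ p q r : ZMod 2,
    (p + q + 1) * (r + 1) + ((r + 1) * p + (r + 1) * (q + 1)) = 0 := by decide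
  have e2 : ∀ p q r : ZMod 2,
    (p + q + 1) * (r + 1) + ((r + 1) * (p + 1) + q * (p + r + 1)) = p * q := by decide
  simp only [add_assoc] at e1 e2 ⊢
  rw [e1, e2, sgn_zero, one_smul]

/-- The Jacobi identity read as `X_{f,g} = [X_f, X_g]`, including the signs in the definition of
`X_f`. -/
theorem hamiltonian_bracket (hf : f ∈ 𝒜 p) (hg : g ∈ 𝒜 q) :
    sgn (p + q + 1 + 1) • B (B f g) =
      superCommutator (p + 1) (q + 1) (sgn (p + 1) • B f) (sgn (q + 1) • B g) := by
  ext h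
  simp only [superCommutator_apply, LinearMap.smul_apply, map_smul, smul_smul, ← sgn_add]
  rw [hB.jacobi h hf hg, smul_add, smul_smul, ← sgn_add]
  have e1 : ∀ p q : ZMod 2, p + q + 1 + 1 = p + 1 + (q + 1) := by decide
  rw [e1, add_comm (q + 1) (p + 1), add_comm (p + 1 + (q + 1)) ((p + 1) * (q + 1))]
  simp

end IsOddBracket

namespace CoordSystem

variable [GradedAlgebra 𝒜] {n m : ℕ} (C : CoordSystem 𝒜 n m) (hc : IsSupercomm 𝒜)
  {p q : ZMod 2} {X Y : R →ₗ[ℝ] R}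

include hc in
/-- The divergence of a commutator with respect to an invertible density. -/
theorem lie_superCommutator {ρ u v : R} (hρ : ρ ∈ 𝒜 0)
    (hX : IsSuperDer 𝒜 p X) (hY : IsSuperDer 𝒜 q Y) (hu : u ∈ 𝒜 p) (hv : v ∈ 𝒜 q)
    (hXu : C.lie p ρ X = u * ρ) (hYv : C.lie q ρ Y = v * ρ) :
    C.lie (p + q) ρ (superCommutator p q X Y) = (X v - sgn (p * q) • Y u) * ρ := by
  rw [C.lie_eq hc hρ (hX.superCommutator hY), C.lie_one_superCommutator hc hX hY,
    superCommutator_apply]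
  set a := C.lie p 1 X with ha
  set b := C.lie q 1 Y with hb
  have h1 : (1 : R) ∈ 𝒜 0 := SetLike.GradedOne.one_mem
  have hma : a ∈ 𝒜 p := C.lie_mem h1 hX
  have hmb : b ∈ 𝒜 q := C.lie_mem h1 hY
  rw [C.lie_eq hc hρ hX, ← ha] at hXu
  rw [C.lie_eq hc hρ hY, ← hb] at hYv
  have hX1 : X ρ ∈ 𝒜 p := by simpa using hX.mem hρ
  have hY1 : Y ρ ∈ 𝒜 q := by simpa using hY.mem hρ
  have hXe : X ρ = ρ * (u - a) := by
    rw [mul_sub, even_mul_comm hc hρ hu, ← hXu]; abel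
  have hYe : Y ρ = ρ * (v - b) := by
    rw [mul_sub, even_mul_comm hc hρ hv, ← hYv]; abel
  -- Each equation `ρ · (flat divergence) + (derivative of ρ) = (divergence) · ρ` is differentiated
  -- along the other field, which produces the second derivatives `X(Yρ)` and `Y(Xρ)` of the
  -- commutator.
  have e1 := congrArg X hYv
  have e2 := congrArg Y hXu
  rw [map_add, hX.leibniz _ hρ, hX.leibniz _ hv, mul_zero, sgn_zero, one_smul] at e1
  rw [map_add, hY.leibniz _ hρ, hY.leibniz _ hu, mul_zero, sgn_zero, one_smul] at e2
  have f1 : v * X ρ = sgn (p * q) • (X ρ * v) := hc.comm hX1 hv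
  have f2 : u * Y ρ = sgn (p * q) • (Y ρ * u) := by rw [mul_comm p]; exact hc.comm hY1 hu
  rw [f1, smul_smul, sgn_mul_sgn_self, one_smul] at e1
  rw [f2, smul_smul, mul_comm q p, sgn_mul_sgn_self, one_smul] at e2
  have g1 : X v * ρ = ρ * X b + X (Y ρ) - X ρ * (v - b) := by
    rw [← add_right_cancel_iff (a := X ρ * v), ← e1]; noncomm_ring
  have g2 : Y u * ρ = ρ * Y a + Y (X ρ) - Y ρ * (u - a) := by
    rw [← add_right_cancel_iff (a := Y ρ * u), ← e2]; noncomm_ring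
  -- Both sides are `ρ(u - a)(v - b)` up to order and sign, since `Xρ = ρ(u - a)` and `Yρ = ρ(v -
  -- b)`; so they drop out of the difference.
  have g3 : X ρ * (v - b) = sgn (p * q) • (Y ρ * (u - a)) := by
    rw [hXe, hYe, mul_assoc, mul_assoc,
      hc.comm (Submodule.sub_mem _ hv hmb) (Submodule.sub_mem _ hu hma), mul_smul_comm, mul_comm q p]
  rw [sub_mul, smul_mul_assoc, g1, g2, g3]
  simp only [mul_sub, smul_sub, smul_add, mul_smul_comm]
  abel

end CoordSystem

/-- An operator with `Δ f = div X_f` in a coordinate system. -/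
def IsLaplacian [GradedAlgebra 𝒜] {n m : ℕ} (C : CoordSystem 𝒜 n m) (B : R →ₗ[ℝ] R →ₗ[ℝ] R)
    (ρ : R) (D : R →ₗ[ℝ] R) : Prop :=
  ∀ (p : ZMod 2) (f : R), f ∈ 𝒜 p → C.lie (p + 1) ρ (sgn (p + 1) • B f) = D f * ρ

namespace IsLaplacian

variable [GradedAlgebra 𝒜] {n m : ℕ} {C : CoordSystem 𝒜 n m} {B : R →ₗ[ℝ] R →ₗ[ℝ] R}
  {ρ : R} {D : R →ₗ[ℝ] R} (hD : IsLaplacian C B ρ D) (hc : IsSupercomm 𝒜)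
  (hB : IsOddBracket 𝒜 B) (hρ : ρ ∈ 𝒜 0) (hρu : IsUnit ρ) {p q : ZMod 2} {f g : R}

include hD hB hρ hρu

theorem mem (hf : f ∈ 𝒜 p) : D f ∈ 𝒜 (p + 1) := by
  obtain ⟨u, rfl⟩ := hρu
  have h := hD p f hf
  rw [← Units.mul_inv_eq_iff_eq_mul] at h
  rw [← h]
  have h2 := SetLike.GradedMul.mul_mem (C.lie_mem hρ ((hB.isSuperDer hf).smul (sgn (p + 1))))
    (inverse_mem hρ u.mul_inv u.inv_mul)
  rwa [add_zero] at h2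

include hc

/-- The bracket measures the failure of the Laplacian to be a derivation. -/
theorem map_mul (hf : f ∈ 𝒜 p) (hg : g ∈ 𝒜 q) :
    D (f * g) = D f * g + sgn p • (f * D g) + (2 * sgn (p + 1)) • B f g := by
  refine hρu.mul_right_cancel ?_
  rw [← hD _ _ (SetLike.GradedMul.mul_mem hf hg), hB.mul_left hc hf hg, smul_add, smul_smul,
    C.lie_add, C.lie_smul, C.lie_smul, ← sgn_add]
  -- These two expansions contain one bracket term each, `{g,f}` and `{f,g}`; antisymmetry makes
  -- them equal, whence the factor `2`.
  have e1 := C.lie_mulLeft hc hρ hf (hB.isSuperDer hg)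
  have e2 := C.lie_mulLeft hc hρ hg (hB.isSuperDer hf)
  rw [show p + (q + 1) = p + q + 1 by ring] at e1
  rw [show q + (p + 1) = p + q + 1 by ring] at e2
  have h1 := hD p f hf
  have h2 := hD q g hg
  have hl : ∀ (r : ZMod 2) (a b : R), sgn r • a = b → a = sgn r • b := by
    rintro r a b rfl; rw [smul_smul, sgn_mul_sgn_self, one_smul]
  rw [C.lie_smul] at h1 h2
  rw [e1, e2, hl _ _ _ h1, hl _ _ _ h2, hB.symm hg hf,
    even_mul_comm hc hρ (Submodule.neg_mem _ (Submodule.smul_mem _ _ (hB.mem hf hg))),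
    even_mul_comm hc hρ (hB.mem hf hg), mul_smul_comm, mul_smul_comm, ← mul_assoc, ← mul_assoc,
    hc.comm (hD.mem hB hρ hρu hf) hg]
  simp only [smul_add, smul_neg, smul_smul, ← sgn_add, add_mul, smul_mul_assoc, neg_mul]
  have i1 : ∀ p q : ZMod 2, p + q + 1 + (q + 1) = p := by decide
  have i2 : ∀ p q : ZMod 2, p + q + 1 + p * q + (p + 1 + (p + 1) * q) = 0 := by decide
  have i3 : ∀ p q : ZMod 2, p + q + 1 + p * (q + 1) + (q + 1) * (p + 1) = p := by decide
  have i4 : ∀ p q : ZMod 2, p + q + 1 + p * q + q * (p + 1) = p + 1 := by decide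
  simp only [add_assoc, add_mul] at i1 i2 i3 i4 ⊢
  rw [i1, i2, i3, i4, sgn_add p 1, sgn_one, sgn_zero]
  module

/-- The Laplacian is a derivation of the bracket. -/
theorem map_bracket (hf : f ∈ 𝒜 p) (hg : g ∈ 𝒜 q) :
    D (B f g) = B (D f) g + sgn (p + 1) • B f (D g) := by
  refine hρu.mul_right_cancel ?_
  rw [← hD _ _ (hB.mem hf hg), hB.hamiltonian_bracket hf hg,
    show p + q + 1 + 1 = p + 1 + (q + 1) by ring,
    C.lie_superCommutator hc hρ ((hB.isSuperDer hf).smul _) ((hB.isSuperDer hg).smul _)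
    (hD.mem hB hρ hρu hf) (hD.mem hB hρ hρu hg) (hD p f hf) (hD q g hg),
    LinearMap.smul_apply, LinearMap.smul_apply, hB.symm hg (hD.mem hB hρ hρu hf)]
  simp only [smul_neg, smul_smul, ← sgn_add]
  rw [(by decide : ∀ p q : ZMod 2,
    (p + 1) * (q + 1) + (q + 1 + (q + 1) * (p + 1 + 1)) = 0)]
  simp [add_comm]

/-- Apply `Δ` to `map_mul`. The two `Δf Δg` terms have opposite signs, and `Δ{f,g}`, expanded by
`map_bracket`, cancels the brackets created by the second use of `map_mul`. -/
theorem sq_map_mul (hf : f ∈ 𝒜 p) (g : R) : D (D (f * g)) = D (D f) * g + f * D (D g) := by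
  have h : D ∘ₗ D ∘ₗ LinearMap.mulLeft ℝ f =
      LinearMap.mulLeft ℝ (D (D f)) + LinearMap.mulLeft ℝ f ∘ₗ D ∘ₗ D := by
    refine linearMap_eq_of_homogeneous (𝒜 := 𝒜) fun q g hg => ?_
    have hDf := hD.mem hB hρ hρu hf
    have hDg := hD.mem hB hρ hρu hg
    simp only [LinearMap.add_apply, LinearMap.comp_apply, LinearMap.mulLeft_apply,
      hD.map_mul hc hB hρ hρu hf hg, map_add, map_smul, hD.map_mul hc hB hρ hρu hDf hg,
      hD.map_mul hc hB hρ hρu hf hDg, hD.map_bracket hc hB hρ hρu hf hg, sgn_add, sgn_one]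
    rcases sgn_eq_or p with h | h <;> rw [h] <;> module
  exact LinearMap.congr_fun h g

/-- The square of an odd derivation is a derivation: the terms `{Δf,Δg}` arise twice with opposite
signs, because `Δf` and `f` have opposite parities. -/
theorem sq_map_bracket (hf : f ∈ 𝒜 p) (g : R) :
    D (D (B f g)) = B (D (D f)) g + B f (D (D g)) := by
  have h : D ∘ₗ D ∘ₗ B f = B (D (D f)) + B f ∘ₗ D ∘ₗ D := by
    refine linearMap_eq_of_homogeneous (𝒜 := 𝒜) fun q g hg => ?_
    have hDf := hD.mem hB hρ hρu hf
    have hDg := hD.mem hB hρ hρu hg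
    simp only [LinearMap.add_apply, LinearMap.comp_apply, hD.map_bracket hc hB hρ hρu hf hg,
      map_add, map_smul, hD.map_bracket hc hB hρ hρu hDf hg,
      hD.map_bracket hc hB hρ hρu hf hDg, sgn_add, sgn_one]
    rcases sgn_eq_or p with h | h <;> rw [h] <;> module
  exact LinearMap.congr_fun h g

end IsLaplacian

end Algebra

/-! ### Derivatives of determinants and nilpotent perturbations -/

/-- Derivations take values in a module because an odd superderivation maps the even part, where
determinants live, out of itself. -/
theorem derivation_prod {A M ι : Type*} [CommRing A] [AddCommGroup M] [Module A M]
    (D : Derivation ℤ A M) [DecidableEq ι] (s : Finset ι) (f : ι → A) :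
    D (∏ i ∈ s, f i) = ∑ i ∈ s, (∏ j ∈ s.erase i, f j) • D (f i) := by
  induction s using Finset.induction_on with
  | empty => simp
  | insert a s ha ih =>
    rw [Finset.prod_insert ha, D.leibniz, ih, Finset.sum_insert ha, Finset.erase_insert ha,
      Finset.smul_sum, add_comm]
    congr 1
    refine Finset.sum_congr rfl fun i hi => ?_
    have hne : a ≠ i := fun h => ha (h ▸ hi)
    rw [Finset.erase_insert_of_ne hne, Finset.prod_insert (fun h => ha (Finset.mem_of_mem_erase h)),
      smul_smul]

/-- Jacobi's formula for the derivative of a determinant. -/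
theorem derivation_det {A M ι : Type*} [CommRing A] [AddCommGroup M] [Module A M]
    (D : Derivation ℤ A M) [DecidableEq ι] [Fintype ι] {B E : Matrix ι ι A} (hBE : B * E = 1) :
    D B.det = B.det • ∑ i, ∑ k, E i k • D (B k i) := by
  have hadj : B.adjugate = B.det • E := by
    calc B.adjugate = B.adjugate * (B * E) := by rw [hBE, mul_one]
      _ = B.det • E := by rw [← mul_assoc, Matrix.adjugate_mul, Matrix.smul_mul, one_mul]
  -- `det B · E` is the adjugate, so its entries are cofactors: sums over the permutations sending
  -- `i` to `k` with the factor at `i` removed. These are the coefficients that the Leibniz rule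
  -- produces.
  have hcof : ∀ i k, B.det * E i k =
      ∑ s : Equiv.Perm ι, if s i = k then (Equiv.Perm.sign s : ℤ) *
        ∏ j ∈ Finset.univ.erase i, B (s j) j else 0 := by
    intro i k
    have h1 : B.det * E i k = (B.updateCol i (Pi.single k 1)).det := by
      rw [← Matrix.cramer_apply, Matrix.cramer_eq_adjugate_mulVec, hadj, Matrix.mulVec_single_one]
      simp
    rw [h1, Matrix.det_apply']
    refine Finset.sum_congr rfl fun s _ => ?_
    rw [← Finset.mul_prod_erase _ _ (Finset.mem_univ i), Matrix.updateCol_self, Pi.single_apply]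
    have h2 : ∏ j ∈ Finset.univ.erase i, B.updateCol i (Pi.single k 1) (s j) j =
        ∏ j ∈ Finset.univ.erase i, B (s j) j :=
      Finset.prod_congr rfl fun j hj => Matrix.updateCol_ne (Finset.ne_of_mem_erase hj)
    rw [h2]
    split_ifs <;> simp
  simp only [Finset.smul_sum, smul_smul, hcof, Finset.sum_smul]
  rw [Matrix.det_apply', map_sum]
  calc ∑ s : Equiv.Perm ι, D (((Equiv.Perm.sign s : ℤ) : A) * ∏ i, B (s i) i)
      = ∑ s : Equiv.Perm ι, ∑ i, (((Equiv.Perm.sign s : ℤ) : A) *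
          ∏ j ∈ Finset.univ.erase i, B (s j) j) • D (B (s i) i) := by
        refine Finset.sum_congr rfl fun s _ => ?_
        rw [D.leibniz, Derivation.map_intCast, smul_zero, add_zero, derivation_prod,
          Finset.smul_sum]
        simp only [smul_smul]
    _ = _ := by
        rw [Finset.sum_comm]
        refine Finset.sum_congr rfl fun i _ => ?_
        rw [Finset.sum_comm]
        refine Finset.sum_congr rfl fun s _ => ?_
        rw [Finset.sum_eq_single (s i)]
        · simp
        · intro k _ hk
          rw [if_neg (fun h => hk h.symm), zero_smul]
        · simp

/-- Modulo the nilradical the matrix is the identity, so its determinant is `1` plus a nilpotent. -/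
theorem isUnit_det_one_sub_of_isNilpotent {A ι : Type*} [CommRing A] [DecidableEq ι] [Fintype ι]
    {N : Matrix ι ι A} (hN : ∀ i j, IsNilpotent (N i j)) : IsUnit (1 - N).det := by
  let φ := Ideal.Quotient.mk (nilradical A)
  have h1 : φ.mapMatrix (1 - N) = 1 := by
    rw [map_sub, map_one, sub_eq_self]
    ext i j
    exact Ideal.Quotient.eq_zero_iff_mem.2 (hN i j)
  have h2 : φ ((1 - N).det - 1) = 0 := by
    rw [map_sub, RingHom.map_det, h1, Matrix.det_one, map_one, sub_self]
  have h3 : IsNilpotent ((1 - N).det - 1) := Ideal.Quotient.eq_zero_iff_mem.1 h2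
  simpa using h3.isUnit_one_add

theorem ringInverse_eq {R : Type*} [Ring R] {u v : R} (huv : u * v = 1) (hvu : v * u = 1) :
    Ring.inverse u = v :=
  Ring.inverse_unit (⟨u, v, huv, hvu⟩ : Rˣ)

/-! ### The commutative ring of even elements -/

section Algebra

variable {R : Type*} [Ring R] [Algebra ℝ R] (𝒜 : ZMod 2 → Submodule ℝ R) [GradedAlgebra 𝒜]

/-- The even part of a superalgebra. -/
def evenSubalgebra : Subalgebra ℝ R where
  carrier := 𝒜 0
  mul_mem' ha hb := by simpa using SetLike.GradedMul.mul_mem (A := 𝒜) ha hb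
  add_mem' ha hb := Submodule.add_mem _ ha hb
  algebraMap_mem' r := by
    rw [Algebra.algebraMap_eq_smul_one]
    exact Submodule.smul_mem _ _ SetLike.GradedOne.one_mem

instance [Fact (IsSupercomm 𝒜)] : CommRing (evenSubalgebra 𝒜) :=
  { (inferInstance : Ring (evenSubalgebra 𝒜)) with
    mul_comm := fun a b => Subtype.ext (even_mul_comm (Fact.out : IsSupercomm 𝒜) a.2 b.2) }

/-- The inclusion of the even part. -/
def evenVal [Fact (IsSupercomm 𝒜)] : evenSubalgebra 𝒜 →+* R where
  toFun := Subtype.val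
  map_one' := rfl
  map_mul' _ _ := rfl
  map_zero' := rfl
  map_add' _ _ := rfl

variable {𝒜}

/-- A superderivation restricts to a derivation of the even part. -/
def evenDerivation [Fact (IsSupercomm 𝒜)] {q : ZMod 2} {X : R →ₗ[ℝ] R} (hX : IsSuperDer 𝒜 q X) :
    Derivation ℤ (evenSubalgebra 𝒜) R where
  toFun f := X f
  map_add' f g := X.map_add f g
  map_smul' r f := by
    change X (((r • f : evenSubalgebra 𝒜)) : R) = r • X f
    rw [← map_zsmul]
    rfl
  map_one_eq_zero' := hX.map_one
  leibniz' f g := by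
    have h := hX.leibniz (g : R) f.2
    rw [mul_zero, sgn_zero, one_smul] at h
    have hg := hX.mem f.2
    rw [add_zero] at hg
    change X ((f : R) * g) = (f : R) * X g + (g : R) * X f
    rw [h, even_mul_comm (Fact.out : IsSupercomm 𝒜) g.2 hg, add_comm]

/-- Even entries commute, so the order of factors is immaterial and the theory of determinants over
commutative rings applies. -/
theorem leibnizDet_evenVal [Fact (IsSupercomm 𝒜)] {k : ℕ}
    (B : Matrix (Fin k) (Fin k) (evenSubalgebra 𝒜)) :
    leibnizDet ((evenVal 𝒜).mapMatrix B) = evenVal 𝒜 B.det := by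
  rw [leibnizDet, Matrix.det_apply, map_sum]
  refine Finset.sum_congr rfl fun s _ => ?_
  rw [Units.smul_def, Units.smul_def, map_zsmul, ← List.prod_ofFn, map_list_prod, List.map_ofFn]
  rfl

theorem exists_evenVal_mapMatrix [Fact (IsSupercomm 𝒜)] {ι κ : Type*} {B : Matrix ι κ R}
    (hB : ∀ i j, B i j ∈ 𝒜 0) :
    ∃ B₀ : Matrix ι κ (evenSubalgebra 𝒜), B₀.map (evenVal 𝒜) = B :=
  ⟨Matrix.of fun i j => ⟨B i j, hB i j⟩, rfl⟩

end Algebra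

/-! ### Supermatrices, supertrace and block decomposition -/

section Algebra

open SuperSheaf Matrix

variable {R : Type*} [Ring R] [Algebra ℝ R] {𝒜 : ZMod 2 → Submodule ℝ R} [GradedAlgebra 𝒜]
  {n m : ℕ}

/-- A square supermatrix with homogeneous entries, of parity `q`. -/
def IsHomMatrix (𝒜 : ZMod 2 → Submodule ℝ R) (q : ZMod 2)
    (J : Matrix (Idx n m) (Idx n m) R) : Prop :=
  ∀ a b, J a b ∈ 𝒜 (q + par a + par b)

theorem IsHomMatrix.mul {p q : ZMod 2} {J K : Matrix (Idx n m) (Idx n m) R}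
    (hJ : IsHomMatrix 𝒜 p J) (hK : IsHomMatrix 𝒜 q K) : IsHomMatrix 𝒜 (p + q) (J * K) := by
  intro a b
  rw [mul_apply]
  refine Submodule.sum_mem _ fun c _ => ?_
  convert SetLike.GradedMul.mul_mem (hJ a c) (hK c b) using 2
  exact (by decide : ∀ p q a b c : ZMod 2,
    p + q + a + b = p + a + c + (q + c + b)) _ _ _ _ _

/-- The supertrace. -/
def strace (J : Matrix (Idx n m) (Idx n m) R) : R := ∑ a, sgn (par a) • J a a

-- Cyclicity of the supertrace. The twist of `J` is the sign that a parity `q` operator picks up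
-- when passing the entries of `J`, exactly as in `map_superDer_mul`, so the two lemmas compose
-- without residual signs.
omit [GradedAlgebra 𝒜] in
theorem strace_mul_comm (hc : IsSupercomm 𝒜) {q : ZMod 2} {J K : Matrix (Idx n m) (Idx n m) R}
    (hJ : IsHomMatrix 𝒜 0 J) (hK : IsHomMatrix 𝒜 q K) :
    strace ((of fun a b => sgn (q * (par a + par b)) • J a b) * K) = strace (K * J) := by
  simp only [strace, mul_apply, of_apply, Finset.smul_sum]
  rw [Finset.sum_comm]
  refine Finset.sum_congr rfl fun e _ => Finset.sum_congr rfl fun c _ => ?_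
  rw [smul_mul_assoc, hc.comm (hK e c) (hJ c e), smul_smul, smul_smul, ← sgn_add, ← sgn_add]
  congr 2
  exact (by decide : ∀ c e q : ZMod 2,
    c + q * (c + e) + (q + e + c) * (0 + c + e) = e) _ _ _

omit [GradedAlgebra 𝒜] in
theorem map_superDer_mul {q : ZMod 2} {X : R →ₗ[ℝ] R} (hX : IsSuperDer 𝒜 q X)
    {J K : Matrix (Idx n m) (Idx n m) R} (hJ : IsHomMatrix 𝒜 0 J) :
    (J * K).map X = J.map X * K +
      (of fun a b => sgn (q * (par a + par b)) • J a b) * K.map X := by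
  ext a b
  simp only [map_apply, mul_apply, Matrix.add_apply, of_apply, map_sum, ← Finset.sum_add_distrib]
  refine Finset.sum_congr rfl fun c _ => ?_
  rw [hX.leibniz _ (hJ a c), zero_add, smul_mul_assoc]

omit [GradedAlgebra 𝒜] in
theorem IsHomMatrix.map {p q : ZMod 2} {X : R →ₗ[ℝ] R} (hX : IsSuperDer 𝒜 q X)
    {J : Matrix (Idx n m) (Idx n m) R} (hJ : IsHomMatrix 𝒜 p J) :
    IsHomMatrix 𝒜 (q + p) (J.map X) := fun a b => by
  simpa only [add_assoc, map_apply] using hX.mem (hJ a b)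

/-- The logarithmic superderivative is additive on products. -/
theorem strace_logDeriv_mul (hc : IsSupercomm 𝒜) {q : ZMod 2} {X : R →ₗ[ℝ] R}
    (hX : IsSuperDer 𝒜 q X) {J₁ K₁ J₂ K₂ : Matrix (Idx n m) (Idx n m) R}
    (hJ₁ : IsHomMatrix 𝒜 0 J₁) (hK₁ : IsHomMatrix 𝒜 0 K₁) (hJ₂ : IsHomMatrix 𝒜 0 J₂)
    (hK₂ : IsHomMatrix 𝒜 0 K₂) (h₁ : K₁ * J₁ = 1) (h₂ : J₂ * K₂ = 1) :
    strace ((J₁ * J₂).map X * (K₂ * K₁)) =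
      strace (J₁.map X * K₁) + strace (J₂.map X * K₂) := by
  have hadd : ∀ J K : Matrix (Idx n m) (Idx n m) R, strace (J + K) = strace J + strace K := by
    intro J K; simp only [strace, Matrix.add_apply, smul_add, Finset.sum_add_distrib]
  rw [map_superDer_mul hX hJ₁, add_mul, hadd]
  congr 1
  · rw [mul_assoc, ← mul_assoc J₂, h₂, one_mul]
  · have hq : IsHomMatrix 𝒜 q (J₂.map X * (K₂ * K₁)) := by
      simpa using (hJ₂.map hX).mul (hK₂.mul hK₁)
    rw [mul_assoc, strace_mul_comm hc hJ₁ hq, mul_assoc, mul_assoc, h₁, mul_one]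

/-- The block decomposition of an even invertible supermatrix and its Berezinian. -/
theorem exists_block_decomposition [Fact (IsSupercomm 𝒜)] {J K : Matrix (Idx n m) (Idx n m) R}
    (hJ : IsHomMatrix 𝒜 0 J) (hK : IsHomMatrix 𝒜 0 K) (hJK : J * K = 1) :
    ∃ (S T : Matrix (Fin n) (Fin n) (evenSubalgebra 𝒜))
      (D E : Matrix (Fin m) (Fin m) (evenSubalgebra 𝒜)),
      S * T = 1 ∧ D * E = 1 ∧ J.toBlocks₂₂ = D.map (evenVal 𝒜) ∧
      J.toBlocks₁₁ - J.toBlocks₁₂ * E.map (evenVal 𝒜) * J.toBlocks₂₁ = S.map (evenVal 𝒜) ∧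
      Ring.inverse J.toBlocks₂₂ = E.map (evenVal 𝒜) := by
  have hc : IsSupercomm 𝒜 := Fact.out
  have hinj : ∀ {k : ℕ}, Function.Injective
      fun B : Matrix (Fin k) (Fin k) (evenSubalgebra 𝒜) => B.map (evenVal 𝒜) :=
    fun {k} => Matrix.map_injective (Subtype.val_injective)
  have hb := congrArg toBlocks₁₁ hJK
  have hb21 := congrArg toBlocks₂₁ hJK
  have hb22 := congrArg toBlocks₂₂ hJK
  rw [← fromBlocks_toBlocks J, ← fromBlocks_toBlocks K, fromBlocks_multiply, ← fromBlocks_one]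
    at hb hb21 hb22
  simp only [toBlocks_fromBlocks₁₁, toBlocks_fromBlocks₂₁, toBlocks_fromBlocks₂₂] at hb hb21 hb22
  have hpar : ∀ {a b : Idx n m}, 0 + par a + par b = 0 → J a b ∈ 𝒜 0 ∧ K a b ∈ 𝒜 0 :=
    fun {a b} h => ⟨h ▸ hJ a b, h ▸ hK a b⟩
  obtain ⟨D, hD⟩ := exists_evenVal_mapMatrix (𝒜 := 𝒜) (B := J.toBlocks₂₂)
    fun i j => (hpar (a := Sum.inr i) (b := Sum.inr j) rfl).1
  obtain ⟨D', hD'⟩ := exists_evenVal_mapMatrix (𝒜 := 𝒜) (B := K.toBlocks₂₂)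
    fun i j => (hpar (a := Sum.inr i) (b := Sum.inr j) rfl).2
  obtain ⟨T, hT⟩ := exists_evenVal_mapMatrix (𝒜 := 𝒜) (B := K.toBlocks₁₁)
    fun i j => (hpar (a := Sum.inl i) (b := Sum.inl j) rfl).2
  -- products of odd entries are nilpotent
  have hodd : ∀ {f : R}, f ∈ 𝒜 1 → f * f = 0 := by
    intro f hf
    have h := hc.comm hf hf
    rw [mul_one, sgn_one, neg_smul, one_smul] at h
    have h2 : (2 : ℝ) • (f * f) = 0 := by rw [two_smul]; nth_rewrite 1 [h]; simp
    exact (smul_eq_zero.1 h2).resolve_left two_ne_zero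
  -- The lower right block of `JK = 1` gives `1 - DD' = J₂₁K₁₂`. Its entries are sums of products of
  -- two odd elements, each of square zero, and in the commutative even part such sums are
  -- nilpotent. Hence `D` is invertible.
  have hN : ∀ i j, IsNilpotent ((1 - D * D') i j) := by
    intro i j
    have h1 : ∀ k : Fin n, J (Sum.inr i) (Sum.inl k) ∈ 𝒜 1 := fun k => by
      simpa [par] using hJ (Sum.inr i) (Sum.inl k)
    have h2 : ∀ k : Fin n, K (Sum.inl k) (Sum.inr j) ∈ 𝒜 1 := fun k => by
      simpa [par] using hK (Sum.inl k) (Sum.inr j)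
    let z : Fin n → evenSubalgebra 𝒜 := fun k =>
      ⟨J (Sum.inr i) (Sum.inl k) * K (Sum.inl k) (Sum.inr j), by
        have h := SetLike.GradedMul.mul_mem (h1 k) (h2 k)
        rwa [show (1 : ZMod 2) + 1 = 0 by decide] at h⟩
    have hz : (1 - D * D') i j = ∑ k, z k := by
      have h3 : (evenVal 𝒜).mapMatrix (1 - D * D') = J.toBlocks₂₁ * K.toBlocks₁₂ := by
        rw [map_sub, map_one, map_mul]
        simp only [RingHom.mapMatrix_apply, hD, hD']
        rw [← hb22]; abel
      refine Subtype.ext ?_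
      exact (congrFun (congrFun h3 i) j).trans (mul_apply.trans (map_sum (evenVal 𝒜) z _).symm)
    rw [hz]
    change _ ∈ nilradical _
    refine Ideal.sum_mem _ fun k _ => ⟨2, Subtype.ext ?_⟩
    rw [pow_two]
    change J (Sum.inr i) (Sum.inl k) * K (Sum.inl k) (Sum.inr j) *
      (J (Sum.inr i) (Sum.inl k) * K (Sum.inl k) (Sum.inr j)) = 0
    rw [mul_assoc, ← mul_assoc (K _ _), hc.comm (h1 k) (h2 k), smul_mul_assoc, mul_smul_comm,
      mul_assoc, hodd (h2 k), mul_zero, mul_zero, smul_zero]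
  have hu : IsUnit D.det := by
    have h := isUnit_det_one_sub_of_isNilpotent hN
    rw [sub_sub_cancel, det_mul] at h
    exact isUnit_of_mul_isUnit_left h
  have hDE : D * D⁻¹ = 1 := mul_nonsing_inv _ hu
  have hED : D⁻¹ * D = 1 := nonsing_inv_mul _ hu
  have hDE' : J.toBlocks₂₂ * (D⁻¹).map (evenVal 𝒜) = 1 := by
    rw [← hD]; exact (map_mul (evenVal 𝒜).mapMatrix D D⁻¹).symm.trans (by rw [hDE, map_one])
  have hED' : (D⁻¹).map (evenVal 𝒜) * J.toBlocks₂₂ = 1 := by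
    rw [← hD]; exact (map_mul (evenVal 𝒜).mapMatrix D⁻¹ D).symm.trans (by rw [hED, map_one])
  have hE0 : ∀ i j, (D⁻¹).map (evenVal 𝒜) i j ∈ 𝒜 0 := fun i j => (D⁻¹ i j).2
  obtain ⟨S, hS⟩ := exists_evenVal_mapMatrix (𝒜 := 𝒜)
    (B := J.toBlocks₁₁ - J.toBlocks₁₂ * (D⁻¹).map (evenVal 𝒜) * J.toBlocks₂₁) fun i j => by
      refine Submodule.sub_mem _ (hpar (a := Sum.inl i) (b := Sum.inl j) rfl).1 ?_
      rw [mul_apply]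
      refine Submodule.sum_mem _ fun k _ => ?_
      rw [mul_apply, Finset.sum_mul]
      refine Submodule.sum_mem _ fun l _ => ?_
      exact SetLike.GradedMul.mul_mem (SetLike.GradedMul.mul_mem
        (hJ (Sum.inl i) (Sum.inr l)) (hE0 l k)) (hJ (Sum.inr k) (Sum.inl j))
  refine ⟨S, T, D, D⁻¹, ?_, hDE, hD.symm, hS.symm, ringInverse_eq hDE' hED'⟩
  apply hinj
  change (evenVal 𝒜).mapMatrix (S * T) = (evenVal 𝒜).mapMatrix 1
  rw [map_mul, map_one]
  simp only [RingHom.mapMatrix_apply, hS, hT]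
  -- From the lower left block of `JK = 1`; substituted into the upper left block, it shows that
  -- `K₁₁` is inverse to the Schur complement `S`.
  have h5 : (D⁻¹).map (evenVal 𝒜) * J.toBlocks₂₁ * K.toBlocks₁₁ = -K.toBlocks₂₁ := by
    rw [Matrix.mul_assoc, eq_neg_of_add_eq_zero_left hb21, Matrix.mul_neg, ← Matrix.mul_assoc, hED', Matrix.one_mul]
  rw [Matrix.sub_mul, Matrix.mul_assoc, Matrix.mul_assoc, ← Matrix.mul_assoc _ J.toBlocks₂₁, h5, Matrix.mul_neg, sub_neg_eq_add, hb]

end Algebra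

/-! ### The Berezinian and coordinate independence of the divergence -/

section Algebra

open SuperSheaf Matrix

variable {R : Type*} [Ring R] [Algebra ℝ R] {𝒜 : ZMod 2 → Submodule ℝ R} [GradedAlgebra 𝒜]
  {n m : ℕ}

theorem one_apply_mem {ι : Type*} [DecidableEq ι] (i j : ι) : (1 : Matrix ι ι R) i j ∈ 𝒜 0 := by
  rw [one_apply]
  split_ifs
  · exact SetLike.GradedOne.one_mem
  · exact Submodule.zero_mem _

omit [GradedAlgebra 𝒜] in
theorem isHomMatrix_fromBlocks {A : Matrix (Fin n) (Fin n) R} {B : Matrix (Fin n) (Fin m) R}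
    {C : Matrix (Fin m) (Fin n) R} {D : Matrix (Fin m) (Fin m) R} (hA : ∀ i j, A i j ∈ 𝒜 0)
    (hB : ∀ i j, B i j ∈ 𝒜 1) (hC : ∀ i j, C i j ∈ 𝒜 1) (hD : ∀ i j, D i j ∈ 𝒜 0) :
    IsHomMatrix 𝒜 0 (fromBlocks A B C D) := by
  rintro (i | i) (j | j)
  · simpa [par] using hA i j
  · simpa [par] using hB i j
  · simpa [par] using hC i j
  · rw [show (0 : ZMod 2) + par (Sum.inr i : Idx n m) + par (Sum.inr j : Idx n m) = 0 from rfl]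
    exact hD i j

theorem superDer_one_apply {q : ZMod 2} {X : R →ₗ[ℝ] R} (hX : IsSuperDer 𝒜 q X) {ι : Type*}
    [DecidableEq ι] (i j : ι) : X ((1 : Matrix ι ι R) i j) = 0 := by
  rw [one_apply]
  split_ifs <;> simp [hX.map_one]

/-- The Berezinian of an even invertible supermatrix is even and invertible, and its logarithmic
superderivative is a supertrace. -/
theorem berezinian_logDeriv (hc : IsSupercomm 𝒜) {J K : Matrix (Idx n m) (Idx n m) R}
    (hJ : IsHomMatrix 𝒜 0 J) (hK : IsHomMatrix 𝒜 0 K) (hJK : J * K = 1) (hKJ : K * J = 1) :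
    berezinian J ∈ 𝒜 0 ∧ IsUnit (berezinian J) ∧
      ∀ {q : ZMod 2} {X : R →ₗ[ℝ] R}, IsSuperDer 𝒜 q X →
        X (berezinian J) = berezinian J * strace (J.map X * K) := by
  have : Fact (IsSupercomm 𝒜) := ⟨hc⟩
  obtain ⟨S, T, D, E, hST, hDE, hD, hS, hE⟩ := exists_block_decomposition hJ hK hJK
  have hTS : T * S = 1 := mul_eq_one_comm.1 hST
  have hED : E * D = 1 := mul_eq_one_comm.1 hDE
  have hdet : D.det * E.det = 1 := by rw [← det_mul, hDE, det_one]
  have hdet' : S.det * T.det = 1 := by rw [← det_mul, hST, det_one]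
  have hber : berezinian J = evenVal 𝒜 (S.det * E.det) := by
    rw [berezinian, hE, hS, hD, ← RingHom.mapMatrix_apply, ← RingHom.mapMatrix_apply,
      leibnizDet_evenVal, leibnizDet_evenVal, map_mul]
    congr 1
    apply ringInverse_eq
    · rw [← map_mul, hdet, map_one]
    · rw [← map_mul, mul_comm, hdet, map_one]
  refine ⟨?_, ?_, ?_⟩
  · rw [hber]; exact (S.det * E.det).2
  · rw [hber]
    refine RingHom.isUnit_map _ (IsUnit.of_mul_eq_one (T.det * D.det) ?_)
    rw [mul_mul_mul_comm, hdet', one_mul, mul_comm, hdet]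
  intro q X hX
  have hval : ∀ {k : ℕ} (A B : Matrix (Fin k) (Fin k) (evenSubalgebra 𝒜)), A * B = 1 →
      A.map (evenVal 𝒜) * B.map (evenVal 𝒜) = 1 := fun A B h =>
    (map_mul (evenVal 𝒜).mapMatrix A B).symm.trans (by rw [h, map_one])
  have hmem : ∀ {k : ℕ} (A : Matrix (Fin k) (Fin k) (evenSubalgebra 𝒜)) (i j),
      A.map (evenVal 𝒜) i j ∈ 𝒜 0 := fun A i j => (A i j).2
  -- the derivative of the Berezinian in terms of the blocks
  have h1 : X (berezinian J) = berezinian J *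
      ((∑ i, ∑ k, D.map (evenVal 𝒜) i k * X (E.map (evenVal 𝒜) k i)) +
        ∑ i, ∑ k, T.map (evenVal 𝒜) i k * X (S.map (evenVal 𝒜) k i)) := by
    rw [hber]
    change evenDerivation hX (S.det * E.det) = _
    rw [Derivation.leibniz, derivation_det _ hST, derivation_det _ hED, smul_smul, smul_smul,
      mul_comm E.det, ← smul_add]
    rfl
  -- Differentiating `DE = 1` turns this sum into minus the trace of `X(D) D⁻¹`, the minus sign of
  -- the supertrace on the odd block.
  have h2 : ∑ i, ∑ k, D.map (evenVal 𝒜) i k * X (E.map (evenVal 𝒜) k i) =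
      -∑ i, ∑ k, X (D.map (evenVal 𝒜) i k) * E.map (evenVal 𝒜) k i := by
    rw [eq_neg_iff_add_eq_zero, ← Finset.sum_add_distrib]
    refine Finset.sum_eq_zero fun i _ => ?_
    have h := congrArg X (congrFun (congrFun (hval D E hDE) i) i)
    rw [superDer_one_apply hX, mul_apply, map_sum] at h
    rw [← h, ← Finset.sum_add_distrib]
    refine Finset.sum_congr rfl fun k _ => ?_
    rw [hX.leibniz _ (hmem D i k), mul_zero, sgn_zero, one_smul, add_comm]
  have h3 : ∑ i, ∑ k, T.map (evenVal 𝒜) i k * X (S.map (evenVal 𝒜) k i) =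
      ∑ i, ∑ k, X (S.map (evenVal 𝒜) i k) * T.map (evenVal 𝒜) k i := by
    rw [Finset.sum_comm]
    exact Finset.sum_congr rfl fun i _ => Finset.sum_congr rfl fun k _ =>
      even_mul_comm hc (hmem T k i) (hX.mem (hmem S i k))
  rw [h1, h2, h3]
  congr 1
  -- the supertrace in terms of the blocks
  have hE1 := hval E D hED
  have hE2 := hval D E hDE
  have hS1 := hval S T hST
  have hS2 := hval T S hTS
  rw [← hD] at hE1 hE2
  have hb : ∀ i j, (J.toBlocks₁₂ * E.map (evenVal 𝒜)) i j ∈ 𝒜 1 := fun i j => by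
    rw [mul_apply]
    refine Submodule.sum_mem _ fun k _ => ?_
    simpa [par, toBlocks₁₂, toBlocks₂₁] using SetLike.GradedMul.mul_mem (hJ (Sum.inl i) (Sum.inr k)) (hmem E k j)
  have hl : ∀ i j, (E.map (evenVal 𝒜) * J.toBlocks₂₁) i j ∈ 𝒜 1 := fun i j => by
    rw [mul_apply]
    refine Submodule.sum_mem _ fun k _ => ?_
    simpa [par, toBlocks₁₂, toBlocks₂₁] using SetLike.GradedMul.mul_mem (hmem E i k) (hJ (Sum.inr k) (Sum.inl j))
  set b := J.toBlocks₁₂ * E.map (evenVal 𝒜) with hbdef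
  set l := E.map (evenVal 𝒜) * J.toBlocks₂₁ with hldef
  have h0 : ∀ {ι κ : Type} (p : ZMod 2) (i : ι) (j : κ), (0 : Matrix ι κ R) i j ∈ 𝒜 p :=
    fun p i j => Submodule.zero_mem _
  have hU := isHomMatrix_fromBlocks (𝒜 := 𝒜) one_apply_mem hb (h0 1) one_apply_mem
  have hU' := isHomMatrix_fromBlocks (𝒜 := 𝒜) (B := -b) one_apply_mem
    (fun i j => Submodule.neg_mem _ (hb i j)) (h0 1) one_apply_mem
  have hL := isHomMatrix_fromBlocks (𝒜 := 𝒜) one_apply_mem (h0 1) hl one_apply_mem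
  have hL' := isHomMatrix_fromBlocks (𝒜 := 𝒜) (C := -l) one_apply_mem (h0 1)
    (fun i j => Submodule.neg_mem _ (hl i j)) one_apply_mem
  have hM := isHomMatrix_fromBlocks (𝒜 := 𝒜) (hmem S) (h0 1) (h0 1) (hmem D)
  have hM' := isHomMatrix_fromBlocks (𝒜 := 𝒜) (hmem T) (h0 1) (h0 1) (hmem E)
  -- Upper unipotent, block diagonal, lower unipotent. The logarithmic derivative is additive over
  -- the factors by `strace_logDeriv_mul`.
  have hJf : J = fromBlocks 1 b 0 1 * (fromBlocks (S.map (evenVal 𝒜)) 0 0 (D.map (evenVal 𝒜)) *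
      fromBlocks 1 0 l 1) := by
    conv_lhs => rw [← fromBlocks_toBlocks J]
    simp only [fromBlocks_multiply, Matrix.one_mul, Matrix.mul_one, Matrix.zero_mul,
      Matrix.mul_zero, add_zero, zero_add, ← hD, ← hS]
    congr 1
    · rw [hldef, ← Matrix.mul_assoc J.toBlocks₂₂, hE2, Matrix.one_mul, hbdef, sub_add_cancel]
    · rw [hbdef, Matrix.mul_assoc, hE1, Matrix.mul_one]
    · rw [hldef, ← Matrix.mul_assoc, hE2, Matrix.one_mul]
  have hUU : (fromBlocks 1 (-b) 0 1 * fromBlocks 1 b 0 1 : Matrix (Idx n m) (Idx n m) R) = 1 := by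
    simp [fromBlocks_multiply]
  have hLL : (fromBlocks 1 0 l 1 * fromBlocks 1 0 (-l) 1 : Matrix (Idx n m) (Idx n m) R) = 1 := by
    simp [fromBlocks_multiply]
  have hMM : fromBlocks (S.map (evenVal 𝒜)) 0 0 (D.map (evenVal 𝒜)) *
      fromBlocks (T.map (evenVal 𝒜)) 0 0 (E.map (evenVal 𝒜)) = 1 := by
    simp [fromBlocks_multiply, hS1, hval D E hDE]
  have hMM' : fromBlocks (T.map (evenVal 𝒜)) 0 0 (E.map (evenVal 𝒜)) *
      fromBlocks (S.map (evenVal 𝒜)) 0 0 (D.map (evenVal 𝒜)) = 1 := by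
    simp [fromBlocks_multiply, hS2, hval E D hED]
  have hML : fromBlocks (S.map (evenVal 𝒜)) 0 0 (D.map (evenVal 𝒜)) * fromBlocks 1 0 l 1 *
      (fromBlocks 1 0 (-l) 1 * fromBlocks (T.map (evenVal 𝒜)) 0 0 (E.map (evenVal 𝒜))) = 1 := by
    rw [mul_assoc, ← mul_assoc (fromBlocks 1 0 l 1), hLL, one_mul, hMM]
  have hKf : K = fromBlocks 1 0 (-l) 1 * fromBlocks (T.map (evenVal 𝒜)) 0 0 (E.map (evenVal 𝒜)) *
      fromBlocks 1 (-b) 0 1 := by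
    refine left_inv_eq_right_inv hKJ ?_
    have hUU' : (fromBlocks 1 b 0 1 * fromBlocks 1 (-b) 0 1 :
        Matrix (Idx n m) (Idx n m) R) = 1 := by
      simp [fromBlocks_multiply]
    conv_lhs => rw [hJf]
    rw [mul_assoc, ← mul_assoc _ _ (fromBlocks 1 (-b) 0 1), hML, one_mul, hUU']
  rw [hKf]
  conv_rhs => rw [hJf]
  have hML0 := hM.mul hL
  have hML0' := hL'.mul hM'
  rw [add_zero] at hML0 hML0'
  rw [strace_logDeriv_mul hc hX hU hU' hML0 hML0' hUU hML,
    strace_logDeriv_mul hc hX hM hM' hL hL' hMM' hLL]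
  -- For a unipotent factor the derivative has only an off-diagonal block, and multiplying by the
  -- inverse leaves a zero diagonal.
  have z1 : strace ((fromBlocks 1 b 0 1).map X * fromBlocks 1 (-b) 0 1) = 0 := by
    simp [strace, mul_apply, Fintype.sum_sum_type, superDer_one_apply hX]
  have z2 : strace ((fromBlocks 1 0 l 1).map X * fromBlocks 1 0 (-l) 1) = 0 := by
    simp [strace, mul_apply, Fintype.sum_sum_type, superDer_one_apply hX]
  rw [z1, z2]
  simp only [strace, mul_apply, Fintype.sum_sum_type, map_apply, fromBlocks_apply₁₁,
    fromBlocks_apply₁₂, fromBlocks_apply₂₁, fromBlocks_apply₂₂, par, Sum.elim_inl, Sum.elim_inr,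
    sgn_zero, sgn_one, one_smul, neg_smul, Matrix.zero_apply, map_zero, mul_zero,
    Finset.sum_const_zero, add_zero, zero_add, Finset.sum_neg_distrib]
  abel

namespace CoordSystem

variable (C C' : CoordSystem 𝒜 n m) (hc : IsSupercomm 𝒜)

/-- The matrix of partial derivatives of the coordinates `C'` with respect to `C`. -/
def jac : Matrix (Idx n m) (Idx n m) R := of fun a b => C.d a (C'.x b)

-- The chain rule: `∂ₐ` of the first system is expanded in the second and applied to the coordinates
-- of the first.
include hc in
theorem jac_mul_jac : C.jac C' * C'.jac C = 1 := by
  ext a b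
  rw [mul_apply, ← C.d_x a b, C'.expand hc (C.d_der a)]
  rfl

omit [GradedAlgebra 𝒜] in
theorem isHomMatrix_jac : IsHomMatrix 𝒜 0 (C.jac C') := fun a b => by
  rw [zero_add]; exact (C.d_der a).mem (C'.x_mem b)

include hc in
theorem berezinian_jac_mem : berezinian (C.jac C') ∈ 𝒜 0 :=
  (berezinian_logDeriv hc (C.isHomMatrix_jac C') (C'.isHomMatrix_jac C) (C.jac_mul_jac C' hc)
    (C'.jac_mul_jac C hc)).1

include hc in
/-- The coordinate fields of `C'` are divergence-free with respect to the coordinate volume form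
of `C'`. -/
theorem lie_berezinian_jac (b : Idx n m) :
    C.lie (par b) (berezinian (C.jac C')) (C'.d b) = 0 := by
  obtain ⟨hB, -, hder⟩ := berezinian_logDeriv hc (C.isHomMatrix_jac C') (C'.isHomMatrix_jac C)
    (C.jac_mul_jac C' hc) (C'.jac_mul_jac C hc)
  rw [C.lie_eq hc hB (C'.d_der b), hder (C'.d_der b), ← mul_add]
  convert mul_zero _
  simp only [lie, strace, one_mul, mul_apply, ← Finset.sum_add_distrib]
  refine Finset.sum_eq_zero fun a _ => ?_
  -- Since `∂ₐxₐ` is constant, the commutator of `∂'_b` and `∂ₐ` sends `xₐ` to `∓∂ₐ∂'_b xₐ`, a term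
  -- of the flat divergence of `∂'_b`. Expanded in `C'`, the same value is a diagonal entry of
  -- `∂'_b(J) J⁻¹`. The signs make the two cancel for each `a`.
  have h := C'.expand hc ((C'.d_der b).superCommutator (C.d_der a)) (C.x a)
  have h2 : ∀ e, superCommutator (par b) (par a) (C'.d b) (C.d a) (C'.x e) =
      C'.d b (C.jac C' a e) := by
    intro e
    rw [superCommutator_apply, C'.d_x, superDer_one_apply (C.d_der a), smul_zero, sub_zero]
    rfl
  simp only [h2] at h
  rw [superCommutator_apply, C.d_x, superDer_one_apply (C'.d_der b), zero_sub] at h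
  have h3 : ∑ j, (C.jac C').map (C'.d b) a j * C'.jac C j a =
      ∑ e, C'.d b (C.jac C' a e) * C'.d e (C.x a) := rfl
  rw [h3, ← h, smul_neg, smul_smul, ← sgn_add, mul_add, mul_one, mul_comm (par b), add_comm (par a),
    add_neg_cancel]

include hc in
/-- The Lie derivative of a volume form along a superderivation does not depend on coordinates. -/
theorem lie_berezinian_mul {p : ZMod 2} {X : R →ₗ[ℝ] R} (hX : IsSuperDer 𝒜 p X) {ρ : R}
    (hρ : ρ ∈ 𝒜 0) :
    C.lie p (berezinian (C.jac C') * ρ) X = berezinian (C.jac C') * C'.lie p ρ X := by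
  have hB := C.berezinian_jac_mem C' hc
  set B := berezinian (C.jac C') with hBdef
  have hBρ : B * ρ ∈ 𝒜 0 := by simpa using SetLike.GradedMul.mul_mem hB hρ
  have hXe : X = ∑ b, LinearMap.mulLeft ℝ (X (C'.x b)) ∘ₗ C'.d b := by
    ext f
    rw [C'.expand hc hX f]
    simp
  have hXb : ∀ b, X (C'.x b) ∈ 𝒜 (p + par b) := fun b => hX.mem (C'.x_mem b)
  -- As `∂'_b` has zero divergence for the density `B`, only the derivative of `ρ` survives.
  have hlie : ∀ b, C.lie (par b) (B * ρ) (C'.d b) = B * C'.d b ρ := by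
    intro b
    rw [even_mul_comm hc hB hρ, C.lie_mul hc hB hρ (C'.d_der b), hBdef,
      C.lie_berezinian_jac C' hc b, mul_zero, zero_add]
  rw [C'.lie_eq hc hρ hX, C'.expand hc hX ρ]
  conv_lhs => rw [hXe]
  rw [C.lie_sum, lie, mul_add, Finset.mul_sum, Finset.mul_sum,
    Finset.mul_sum, ← Finset.sum_add_distrib]
  refine Finset.sum_congr rfl fun b _ => ?_
  have h := C.lie_mulLeft hc hBρ (hXb b) (C'.d_der b)
  rw [add_assoc, CharTwo.add_self_eq_zero, add_zero] at h
  rw [h, hlie, ← mul_assoc (X _), ← even_mul_comm hc hB (hXb b), one_mul, add_comm, mul_smul_comm,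
    mul_smul_comm, mul_assoc, mul_assoc]
  congr 3
  exact (by decide : ∀ p b : ZMod 2, (p + b) * b = b * (p + 1)) _ _

end CoordSystem

end Algebra

/-! ### Hadamard's lemma -/

section Analysis

open Set Metric

/-- Induction on the order: the derivative is again such an integral, with values in `E →L[ℝ] V`. So
`V` must vary in the induction, and it shares the universe of `E` to allow this. -/
theorem contDiff_parametric_integral {E : Type u} [NormedAddCommGroup E] [NormedSpace ℝ E]
    [ProperSpace E] (N : ℕ) :
    ∀ {V : Type u} [NormedAddCommGroup V] [NormedSpace ℝ V] [CompleteSpace V] {F : E → ℝ → V},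
      ContDiff ℝ ∞ (Function.uncurry F) → ContDiff ℝ N (fun y => ∫ t in (0 : ℝ)..1, F y t) := by
  induction N with
  | zero =>
    intro V _ _ _ F hF
    exact contDiff_zero.2
      (intervalIntegral.continuous_parametric_intervalIntegral_of_continuous' hF.continuous 0 1)
  | succ N ih =>
    intro V _ _ _ F hF
    let F' : E → ℝ → E →L[ℝ] V := fun y t =>
      (fderiv ℝ (Function.uncurry F) (y, t)).comp (ContinuousLinearMap.inl ℝ E ℝ)
    have hF' : ContDiff ℝ ∞ (Function.uncurry F') :=
      (hF.fderiv_right (m := ∞) (by simp)).clm_comp contDiff_const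
    have hd : ∀ y t, HasFDerivAt (fun y => F y t) (F' y t) y := fun y t =>
      HasFDerivAt.comp (g := Function.uncurry F) (f := fun e => (e, t)) y
        (hF.differentiable (by simp) (y, t)).hasFDerivAt (hasFDerivAt_prodMk_left y t)
    rw [Nat.cast_add, Nat.cast_one, contDiff_succ_iff_hasFDerivAt]
    refine ⟨fun y => ∫ t in (0 : ℝ)..1, F' y t, ih hF', fun y => ?_⟩
    -- Closed balls of the proper space `E` are compact, so the derivative is bounded near `y`
    -- uniformly in `t ∈ [0,1]`, which provides the dominating constant.
    obtain ⟨C, hC⟩ := ((isCompact_closedBall y 1).prod (isCompact_Icc (a := (0 : ℝ))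
      (b := 1))).bddAbove_image (f := fun z => ‖Function.uncurry F' z‖) hF'.continuous.norm.continuousOn
    have hcont : ∀ y, Continuous (F y) := fun y => hF.continuous.comp (Continuous.prodMk_right y)
    have hcont' : Continuous (F' y) := hF'.continuous.comp (Continuous.prodMk_right y)
    refine intervalIntegral.hasFDerivAt_integral_of_dominated_of_fderiv_le (bound := fun _ => C)
      (ball_mem_nhds y one_pos) ?_ ?_ ?_ ?_ ?_ ?_
    · exact Filter.Eventually.of_forall fun z => (hcont z).aestronglyMeasurable
    · exact (hcont y).intervalIntegrable _ _
    · exact hcont'.aestronglyMeasurable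
    · refine Filter.Eventually.of_forall fun t ht z hz =>
        hC ⟨(z, t), ⟨ball_subset_closedBall hz, ?_⟩, rfl⟩
      rw [uIoc_of_le zero_le_one] at ht
      exact ⟨ht.1.le, ht.2⟩
    · exact intervalIntegrable_const
    · exact Filter.Eventually.of_forall fun t _ z _ => hd z t

/-- Hadamard's lemma for smooth functions on `ℝⁿ`. -/
theorem exists_hadamard {n : ℕ} {f : EuclideanSpace ℝ (Fin n) → ℝ} (hf : ContDiff ℝ ∞ f)
    (y₀ : EuclideanSpace ℝ (Fin n)) :
    ∃ g : Fin n → EuclideanSpace ℝ (Fin n) → ℝ, (∀ j, ContDiff ℝ ∞ (g j)) ∧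
      ∀ y, f y = f y₀ + ∑ j, (y j - y₀ j) * g j y := by
  have hfd : ContDiff ℝ ∞ (fderiv ℝ f) := hf.fderiv_right (by simp)
  have hs : ∀ j, ContDiff ℝ ∞ (Function.uncurry fun (y : EuclideanSpace ℝ (Fin n)) (t : ℝ) =>
      fderiv ℝ f (y₀ + t • (y - y₀)) (EuclideanSpace.single j 1)) := fun j =>
    (hfd.comp (by fun_prop : ContDiff ℝ ∞ fun p : EuclideanSpace ℝ (Fin n) × ℝ =>
      y₀ + p.2 • (p.1 - y₀))).clm_apply contDiff_const
  refine ⟨fun j y => ∫ t in (0 : ℝ)..1,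
    fderiv ℝ f (y₀ + t • (y - y₀)) (EuclideanSpace.single j 1), fun j =>
      contDiff_infty.2 fun N => contDiff_parametric_integral N (hs j), fun y => ?_⟩
  have hd : ∀ t : ℝ, HasDerivAt (fun t : ℝ => f (y₀ + t • (y - y₀)))
      (fderiv ℝ f (y₀ + t • (y - y₀)) (y - y₀)) t := fun t => by
    have h1 : HasDerivAt (fun t : ℝ => y₀ + t • (y - y₀)) (y - y₀) t := by
      simpa using ((hasDerivAt_id t).smul_const (y - y₀)).const_add y₀
    exact (hf.differentiable (by simp) _).hasFDerivAt.comp_hasDerivAt t h1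
  have hc : Continuous fun t : ℝ => fderiv ℝ f (y₀ + t • (y - y₀)) (y - y₀) :=
    (hfd.continuous.comp (by fun_prop)).clm_apply continuous_const
  have hcj : ∀ j, Continuous fun t : ℝ =>
      fderiv ℝ f (y₀ + t • (y - y₀)) (EuclideanSpace.single j 1) := fun j =>
    (hfd.continuous.comp (by fun_prop)).clm_apply continuous_const
  have h := intervalIntegral.integral_eq_sub_of_hasDerivAt (a := 0) (b := 1) (fun t _ => hd t)
    (hc.intervalIntegrable _ _)
  have he : y - y₀ = ∑ j, (y j - y₀ j) • EuclideanSpace.single j (1 : ℝ) := by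
    ext k
    simp [Finset.sum_apply, Pi.single_apply]
  have he2 : ∀ t : ℝ, fderiv ℝ f (y₀ + t • (y - y₀)) (y - y₀) =
      ∑ j, (y j - y₀ j) * fderiv ℝ f (y₀ + t • (y - y₀)) (EuclideanSpace.single j 1) := by
    intro t
    have h := congrArg (fderiv ℝ f (y₀ + t • (y - y₀))) he
    simpa only [map_sum, map_smul, smul_eq_mul] using h
  simp only [he2] at h
  rw [intervalIntegral.integral_finsetSum
    fun j _ => ((hcj j).const_mul _).intervalIntegrable _ _] at h
  simp only [intervalIntegral.integral_const_mul, one_smul, zero_smul, add_zero,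
    add_sub_cancel] at h
  rw [h]; ring

/-- Hadamard's lemma for smooth functions on an open subset of `ℝⁿ`. -/
theorem exists_hadamard_on {n : ℕ} {U : Set (EuclideanSpace ℝ (Fin n))} (hU : IsOpen U)
    {f : EuclideanSpace ℝ (Fin n) → ℝ} (hf : ContDiffOn ℝ ∞ f U) {y₀ : EuclideanSpace ℝ (Fin n)}
    (hy₀ : y₀ ∈ U) :
    ∃ g : Fin n → EuclideanSpace ℝ (Fin n) → ℝ, (∀ j, ContDiffOn ℝ ∞ (g j) U) ∧
      ∀ y ∈ U, f y = f y₀ + ∑ j, (y j - y₀ j) * g j y := by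
  obtain ⟨χ, hχ, -, hχs, -, hχ1⟩ := exists_contDiff_tsupport_subset (n := ⊤) (hU.mem_nhds hy₀)
  have hχf : ContDiff ℝ ∞ fun y => χ y * f y := by
    rw [contDiff_iff_contDiffAt]
    intro y
    by_cases hy : y ∈ U
    · exact hχs.contDiffAt.mul (hf.contDiffAt (hU.mem_nhds hy))
    · have h0 : (fun y => χ y * f y) =ᶠ[nhds y] fun _ => 0 := by
        have : (tsupport χ)ᶜ ∈ nhds y :=
          (isClosed_tsupport χ).isOpen_compl.mem_nhds fun h => hy (hχ h)
        filter_upwards [this] with z hz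
        rw [image_eq_zero_of_notMem_tsupport hz, zero_mul]
      exact contDiffAt_const.congr_of_eventuallyEq h0
  obtain ⟨g, hg, hge⟩ := exists_hadamard hχf y₀
  obtain ⟨k, hk, hke⟩ := exists_hadamard hχs y₀
  -- Since `χ(y₀) = 1`, one has `χf = f(y₀) + ∑(yⱼ - y₀ⱼ)gⱼ` and `χ = 1 + ∑(yⱼ - y₀ⱼ)kⱼ`.
  -- Subtracting `f` times the second relation removes `χ`, so the formula holds on all of `U`,
  -- which need not be star-shaped.
  refine ⟨fun j y => g j y - k j y * f y, fun j => (hg j).contDiffOn.sub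
    ((hk j).contDiffOn.mul hf), fun y _ => ?_⟩
  have h1 := hge y
  have h2 := hke y
  have hχ0 : χ y₀ = 1 := hχ1
  rw [hχ0] at h1 h2
  have h3 : ∑ j, (y j - y₀ j) * (g j y - k j y * f y) =
      ∑ j, (y j - y₀ j) * g j y - (∑ j, (y j - y₀ j) * k j y) * f y := by
    rw [Finset.sum_mul, ← Finset.sum_sub_distrib]
    exact Finset.sum_congr rfl fun j _ => by ring
  rw [h3]
  linear_combination h1 - f y * h2

end Analysis

/-! ### Differential calculus with Grassmann values -/

section Grassmann

variable {m : ℕ}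

instance : GradedAlgebra (grassmannPart m) :=
  CliffordAlgebra.gradedAlgebra (0 : QuadraticForm ℝ (Fin m → ℝ))

/-- Contraction with a covector is an odd superderivation of the Grassmann algebra. -/
theorem isSuperDer_contractLeft (d : Module.Dual ℝ (Fin m → ℝ)) :
    IsSuperDer (grassmannPart m) 1
      (CliffordAlgebra.contractLeft (Q := (0 : QuadraticForm ℝ (Fin m → ℝ))) d) := by
  set D : Grassmann m →ₗ[ℝ] Grassmann m :=
    CliffordAlgebra.contractLeft (Q := (0 : QuadraticForm ℝ (Fin m → ℝ))) d with hD
  -- Membership, parity of the image and the Leibniz rule are proved together, because left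
  -- multiplication by one vector changes the parity, while the induction principles for the even
  -- and odd parts multiply by two vectors at a time.
  let P : ZMod 2 → Grassmann m → Prop := fun p a => a ∈ grassmannPart m p ∧
    D a ∈ grassmannPart m (1 + p) ∧ ∀ b, D (a * b) = D a * b + sgn (1 * p) • (a * D b)
  have hadd : ∀ p a b, P p a → P p b → P p (a + b) := by
    rintro p a b ⟨h1, h2, h3⟩ ⟨k1, k2, k3⟩
    refine ⟨Submodule.add_mem _ h1 k1, by rw [map_add]; exact Submodule.add_mem _ h2 k2, ?_⟩
    intro c
    rw [add_mul, map_add, map_add, h3, k3, add_mul, add_mul, smul_add]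
    abel
  have hι : ∀ p v a, P p a → P (1 + p) (ExteriorAlgebra.ι ℝ v * a) := by
    rintro p v a ⟨h1, h2, h3⟩
    have hv : ExteriorAlgebra.ι ℝ v ∈ grassmannPart m 1 :=
      CliffordAlgebra.ι_mem_evenOdd_one _ v
    have hDv : ∀ b, D (ExteriorAlgebra.ι ℝ v * b) = d v • b - ExteriorAlgebra.ι ℝ v * D b :=
      fun b => CliffordAlgebra.contractLeft_ι_mul _ _ _
    refine ⟨SetLike.GradedMul.mul_mem hv h1, ?_, fun b => ?_⟩
    · rw [hDv]
      refine Submodule.sub_mem _ (Submodule.smul_mem _ _ ?_) (SetLike.GradedMul.mul_mem hv h2)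
      rwa [← add_assoc, show (1 : ZMod 2) + 1 = 0 by decide, zero_add]
    · rw [mul_assoc, hDv, hDv, h3, one_mul, one_mul, sgn_add, sgn_one]
      simp only [mul_add, sub_mul, smul_mul_assoc, mul_smul_comm, mul_assoc, neg_mul, one_mul,
        neg_smul]
      abel
  have h11 : (1 : ZMod 2) + (1 + 0) = 0 := by decide
  have h0 : ∀ r, P 0 (algebraMap ℝ _ r) := by
    intro r
    have h : D (algebraMap ℝ _ r) = 0 := CliffordAlgebra.contractLeft_algebraMap _ _ _
    refine ⟨SetLike.algebraMap_mem_graded _ r, by rw [h]; exact Submodule.zero_mem _, fun b => ?_⟩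
    rw [h, zero_mul, zero_add, mul_zero, sgn_zero, one_smul]
    exact CliffordAlgebra.contractLeft_algebraMap_mul _ _ _
  have key : ∀ p a, a ∈ grassmannPart m p → P p a := by
    intro p a ha
    obtain rfl | rfl : p = 0 ∨ p = 1 :=
      (by decide : ∀ p : ZMod 2, p = 0 ∨ p = 1) p
    · induction a, ha using CliffordAlgebra.even_induction with
      | algebraMap r => exact h0 r
      | add x y hx hy h k => exact hadd _ _ _ h k
      | ι_mul_ι_mul v w x hx h =>
        have := hι _ v _ (hι _ w _ h)
        rw [h11, ← mul_assoc] at this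
        exact this
    · induction a, ha using CliffordAlgebra.odd_induction with
      | ι v =>
        have := hι _ v _ (h0 1)
        rwa [map_one, mul_one, add_zero] at this
      | add x y hx hy h k => exact hadd _ _ _ h k
      | ι_mul_ι_mul v w x hx h =>
        have := hι _ v _ (hι _ w _ h)
        rw [← mul_assoc, ← add_assoc, show (1 : ZMod 2) + 1 + 1 = 1 by decide] at this
        exact this
  exact ⟨fun hf => (key _ _ hf).2.1, fun g hf => (key _ _ hf).2.2 g⟩

theorem grassmann_ext {a b : Grassmann m} (h : ∀ l : Module.Dual ℝ (Grassmann m), l a = l b) :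
    a = b := by
  rw [← sub_eq_zero, ← Module.forall_dual_apply_eq_zero_iff ℝ]
  intro l
  rw [map_sub, h, sub_self]

/-- The Leibniz rule for functions with values in the Grassmann algebra, in components. -/
theorem fderiv_grassmann_mul {E : Type*} [NormedAddCommGroup E] [NormedSpace ℝ E]
    {u v : E → Grassmann m} {y e : E} {u' v' : Grassmann m}
    (hu : ∀ l : Module.Dual ℝ (Grassmann m), DifferentiableAt ℝ (fun z => l (u z)) y)
    (hv : ∀ l : Module.Dual ℝ (Grassmann m), DifferentiableAt ℝ (fun z => l (v z)) y)
    (hu' : ∀ l : Module.Dual ℝ (Grassmann m), l u' = fderiv ℝ (fun z => l (u z)) y e)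
    (hv' : ∀ l : Module.Dual ℝ (Grassmann m), l v' = fderiv ℝ (fun z => l (v z)) y e)
    (l : Module.Dual ℝ (Grassmann m)) :
    fderiv ℝ (fun z => l (u z * v z)) y e = l (u' * v y + u y * v') := by
  let b := (Pi.basisFun ℝ (Fin m)).ExteriorAlgebra
  have hexp : ∀ g h : Grassmann m,
      l (g * h) = ∑ i, ∑ j, b.coord i g * b.coord j h * l (b i * b j) := by
    intro g h
    conv_lhs => rw [← b.sum_repr g, ← b.sum_repr h]
    simp only [Finset.sum_mul_sum, map_sum, smul_mul_smul_comm, map_smul, smul_eq_mul,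
      Module.Basis.coord_apply]
  rw [show (fun z => l (u z * v z)) = _ from funext fun z => hexp (u z) (v z), map_add, hexp, hexp]
  have hm : ∀ i j, DifferentiableAt ℝ (fun z => b.coord i (u z) * b.coord j (v z)) y :=
    fun i j => (hu _).mul (hv _)
  have hij : ∀ i j,
      DifferentiableAt ℝ (fun z => b.coord i (u z) * b.coord j (v z) * l (b i * b j)) y :=
    fun i j => (hm i j).mul_const _
  rw [fderiv_fun_sum fun i _ => DifferentiableAt.fun_sum fun j _ => hij i j, sum_apply,
    ← Finset.sum_add_distrib]
  refine Finset.sum_congr rfl fun i _ => ?_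
  rw [fderiv_fun_sum fun j _ => hij i j, sum_apply, ← Finset.sum_add_distrib]
  refine Finset.sum_congr rfl fun j _ => ?_
  rw [fderiv_mul_const (hm i j), fderiv_fun_mul (hu _) (hv _), hu', hv']
  simp only [smul_apply, add_apply, smul_eq_mul]
  ring

end Grassmann

/-! ### Charts as coordinate systems -/

namespace SuperSheaf

variable {X : TopCat.{u}} {A : SuperSheaf X} {n m : ℕ} (c : A.Chart n m) {W : Opens X}
  (hW : W ≤ c.dom)

theorem isSupercomm (A : SuperSheaf X) (U : Opens X) : IsSupercomm (A.grading U) :=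
  ⟨fun hf hg => A.supercomm U hf hg⟩

namespace Chart

theorem val_ext {f g : A.Sec W} (h : ∀ x, c.val W hW f x = c.val W hW g x) : f = g :=
  c.val_injective W hW (funext h)

theorem read_add (f g : A.Sec W) (y) : c.read hW (f + g) y = c.read hW f y + c.read hW g y := by
  unfold read; split_ifs <;> simp

theorem read_smul (r : ℝ) (f : A.Sec W) (y) : c.read hW (r • f) y = r • c.read hW f y := by
  unfold read; split_ifs <;> simp

theorem read_mul (f g : A.Sec W) (y) : c.read hW (f * g) y = c.read hW f y * c.read hW g y := by
  unfold read; split_ifs <;> simp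

theorem read_differentiableAt (f : A.Sec W) (l : Module.Dual ℝ (Grassmann m)) (x : W) :
    DifferentiableAt ℝ (fun y => l (c.read hW f y)) (c.e x) :=
  ((c.read_smooth hW f l).differentiableOn (by simp)).differentiableAt
    ((c.isOpen_image hW).mem_nhds ⟨x, x.2, rfl⟩)

/-- The partial derivatives as linear maps. -/
noncomputable def pderivLin (a : Idx n m) : A.Sec W →ₗ[ℝ] A.Sec W where
  toFun := c.pderiv hW a
  map_add' f g := by
    refine c.val_ext hW fun x => ?_
    rw [map_add, Pi.add_apply]
    cases a with
    | inl j =>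
      refine grassmann_ext fun l => ?_
      simp only [map_add, val_pderiv_even, read_add]
      rw [fderiv_fun_add (c.read_differentiableAt hW f l x) (c.read_differentiableAt hW g l x)]
      rfl
    | inr k => simp only [val_pderiv_odd, map_add, Pi.add_apply]
  map_smul' r f := by
    refine c.val_ext hW fun x => ?_
    rw [map_smul, Pi.smul_apply]
    cases a with
    | inl j =>
      refine grassmann_ext fun l => ?_
      simp only [map_smul, val_pderiv_even, read_smul, smul_eq_mul, RingHom.id_apply]
      rw [fderiv_const_mul (c.read_differentiableAt hW f l x)]
      rfl
    | inr k => simp only [val_pderiv_odd, map_smul, Pi.smul_apply, RingHom.id_apply]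

theorem pderivLin_apply (a : Idx n m) (f : A.Sec W) : c.pderivLin hW a f = c.pderiv hW a f := rfl

theorem isSuperDer_pderivLin (a : Idx n m) :
    IsSuperDer (A.grading W) (par a) (c.pderivLin hW a) where
  mem {q f} hf := by
    rw [c.val_parity W hW] at hf ⊢
    intro x
    rw [pderivLin_apply]
    cases a with
    | inl j =>
      rw [show par (Sum.inl j : Idx n m) + q = q from zero_add q]
      -- Derivatives are known only through linear forms. A form vanishing on the homogeneous part
      -- makes the differentiated function identically zero, so it cannot detect the derivative.
      by_contra hx
      obtain ⟨l, hl, hle⟩ := Submodule.exists_le_ker_of_notMem hx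
      apply hl
      rw [val_pderiv_even]
      have h0 : (fun y => l (c.read hW f y)) = fun _ => 0 := by
        funext y
        refine hle ?_
        unfold read
        split_ifs with h
        · exact hf _
        · exact Submodule.zero_mem _
      rw [h0]
      simp
    | inr k =>
      rw [val_pderiv_odd]
      exact (isSuperDer_contractLeft _).mem (hf x)
  leibniz {q f} g hf := by
    rw [c.val_parity W hW] at hf
    refine c.val_ext hW fun x => ?_
    simp only [map_add, map_smul, map_mul, Pi.add_apply, Pi.smul_apply, Pi.mul_apply,
      pderivLin_apply]
    cases a with
    | inl j =>
      refine grassmann_ext fun l => ?_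
      rw [show par (Sum.inl j : Idx n m) * q = 0 from zero_mul q, sgn_zero, one_smul,
        val_pderiv_even]
      simp only [read_mul]
      rw [fderiv_grassmann_mul (fun l => c.read_differentiableAt hW f l x)
        (fun l => c.read_differentiableAt hW g l x) (fun l => c.val_pderiv_even hW j f x l)
        (fun l => c.val_pderiv_even hW j g x l), read_apply, read_apply]
    | inr k =>
      simp only [val_pderiv_odd, map_mul, Pi.mul_apply]
      exact (isSuperDer_contractLeft _).leibniz _ (hf x)

theorem coord_mem (a : Idx n m) : c.coord hW a ∈ A.grading W (par a) := by
  rw [c.val_parity W hW]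
  intro x
  cases a with
  | inl j => rw [val_coord_even]; exact SetLike.algebraMap_mem_graded _ _
  | inr k => rw [val_coord_odd]; exact CliffordAlgebra.ι_mem_evenOdd_one _ _

theorem pderivLin_coord (a b : Idx n m) :
    c.pderivLin hW a (c.coord hW b) = (1 : Matrix _ _ (A.Sec W)) a b := by
  refine c.val_ext hW fun x => ?_
  rw [pderivLin_apply]
  have hone : ∀ p : Prop, [Decidable p] → c.val W hW (if p then 1 else 0) x =
      if p then 1 else 0 := by
    intro p _; split_ifs <;> simp
  rw [Matrix.one_apply, hone]
  have hnhds : c.e '' W ∈ nhds (c.e x) := (c.isOpen_image hW).mem_nhds ⟨x, x.2, rfl⟩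
  cases a with
  | inl j =>
    refine grassmann_ext fun l => ?_
    rw [val_pderiv_even]
    cases b with
    | inl k =>
      have h : (fun y => l (c.read hW (c.coord hW (Sum.inl k)) y)) =ᶠ[nhds (c.e x)]
          fun y => y k * l 1 := by
        filter_upwards [hnhds]
        rintro _ ⟨z, hz, rfl⟩
        rw [c.read_apply hW _ ⟨z, hz⟩, val_coord_even, Algebra.algebraMap_eq_smul_one, map_smul,
          smul_eq_mul]
      have hp : HasFDerivAt (fun y : EuclideanSpace ℝ (Fin n) => y k)
          (EuclideanSpace.proj k : EuclideanSpace ℝ (Fin n) →L[ℝ] ℝ) (c.e x) :=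
        (EuclideanSpace.proj k : EuclideanSpace ℝ (Fin n) →L[ℝ] ℝ).hasFDerivAt
      rw [h.fderiv_eq, (hp.mul_const (l 1)).fderiv]
      simp only [smul_apply, PiLp.proj_apply, smul_eq_mul, PiLp.single_apply, Sum.inl.injEq]
      by_cases hjk : j = k
      · simp [hjk]
      · simp [hjk, Ne.symm hjk]
    | inr k =>
      have h : (fun y => l (c.read hW (c.coord hW (Sum.inr k)) y)) =ᶠ[nhds (c.e x)]
          fun _ => l (ExteriorAlgebra.ι ℝ (Pi.single k 1 : Fin m → ℝ)) := by
        filter_upwards [hnhds]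
        rintro _ ⟨z, hz, rfl⟩
        rw [c.read_apply hW _ ⟨z, hz⟩, val_coord_odd]
      rw [h.fderiv_eq]
      simp
  | inr j =>
    rw [val_pderiv_odd]
    cases b with
    | inl k => rw [val_coord_even]; simp
    | inr k =>
      rw [val_coord_odd]
      refine (CliffordAlgebra.contractLeft_ι _ _ _).trans ?_
      simp only [LinearMap.proj_apply, Pi.single_apply, Sum.inr.injEq]
      split_ifs <;> simp

/-- The section with given constant value in the Grassmann algebra. -/
theorem exists_const (g : Grassmann m) : ∃ s : A.Sec W, ∀ x, c.val W hW s x = g := by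
  obtain ⟨s, hs⟩ := (c.val_range W hW (fun _ => g)).2
    ⟨fun _ => g, fun _ => rfl, fun l => contDiffOn_const⟩
  exact ⟨s, fun x => congrFun hs x⟩

theorem exists_scalar {φ : EuclideanSpace ℝ (Fin n) → ℝ} (hφ : ContDiffOn ℝ ∞ φ (c.e '' W)) :
    ∃ s : A.Sec W, ∀ x, c.val W hW s x = algebraMap ℝ (Grassmann m) (φ (c.e x)) := by
  obtain ⟨s, hs⟩ := (c.val_range W hW (fun x => algebraMap ℝ (Grassmann m) (φ (c.e x)))).2
    ⟨fun y => algebraMap ℝ (Grassmann m) (φ y), fun _ => rfl, fun l => by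
      simp only [Algebra.algebraMap_eq_smul_one, map_smul, smul_eq_mul]
      exact hφ.mul contDiffOn_const⟩
  exact ⟨s, fun x => congrFun hs x⟩

section

variable {p : ZMod 2} {E : A.Sec W →ₗ[ℝ] A.Sec W} (hE : IsSuperDer (A.grading W) p E)
  (hx : ∀ a, E (c.coord hW a) = 0)

include hE hx

/-- A Grassmann constant is a polynomial in the odd coordinates; the Leibniz rule applies one
generator at a time. -/
theorem superDer_const_eq_zero (g : Grassmann m) {s : A.Sec W} (hs : ∀ x, c.val W hW s x = g) :
    E s = 0 := by
  induction g using CliffordAlgebra.left_induction generalizing s with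
  | algebraMap r =>
    have : s = r • 1 := c.val_ext hW fun x => by
      rw [hs, map_smul, map_one, Algebra.algebraMap_eq_smul_one]; rfl
    rw [this, map_smul, hE.map_one, smul_zero]
  | add a b ha hb =>
    obtain ⟨s₁, h₁⟩ := c.exists_const hW a
    obtain ⟨s₂, h₂⟩ := c.exists_const hW b
    have : s = s₁ + s₂ := c.val_ext hW fun x => by rw [hs, map_add, Pi.add_apply, h₁, h₂]
    rw [this, map_add, ha h₁, hb h₂, add_zero]
  | ι_mul a v ha =>
    obtain ⟨t, ht⟩ := c.exists_const hW a
    have hsum : s = ∑ k, v k • (c.coord hW (Sum.inr k) * t) := c.val_ext hW fun x => by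
      rw [hs, map_sum, Finset.sum_apply]
      simp only [map_smul, map_mul, Pi.smul_apply, Pi.mul_apply, ht, val_coord_odd]
      conv_lhs => rw [pi_eq_sum_univ' v]
      have h1 : ∀ w : Fin m → ℝ, CliffordAlgebra.ι (0 : QuadraticForm ℝ (Fin m → ℝ)) w =
        ExteriorAlgebra.ι ℝ w := fun _ => rfl
      rw [h1, map_sum, Finset.sum_mul]
      refine Finset.sum_congr rfl fun k _ => ?_
      rw [map_smul, smul_mul_assoc]
    rw [hsum, map_sum]
    refine Finset.sum_eq_zero fun k _ => ?_
    rw [map_smul, hE.leibniz _ (c.coord_mem hW _), hx, ha ht]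
    simp

/-- Hadamard's lemma at `x₀` writes `s` as a constant plus `∑(xⱼ - xⱼ(x₀))Gⱼ`. After applying `E`,
each remaining term contains a factor vanishing at `x₀`; as `x₀` is arbitrary, `E s = 0`. No
continuity or locality of `E` is needed. -/
theorem superDer_scalar_eq_zero {φ : EuclideanSpace ℝ (Fin n) → ℝ}
    (hφ : ContDiffOn ℝ ∞ φ (c.e '' W)) {s : A.Sec W}
    (hs : ∀ x, c.val W hW s x = algebraMap ℝ (Grassmann m) (φ (c.e x))) : E s = 0 := by
  refine c.val_ext hW fun x₀ => ?_
  obtain ⟨g, hg, hφg⟩ := exists_hadamard_on (c.isOpen_image hW) hφ ⟨x₀, x₀.2, rfl⟩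
  choose G hG using fun j => c.exists_scalar hW (hg j)
  have hsum : s = φ (c.e x₀) • 1 +
      ∑ j, (c.coord hW (Sum.inl j) - c.e x₀ j • (1 : A.Sec W)) * G j := c.val_ext hW fun x => by
    rw [hs, hφg (c.e x) ⟨x, x.2, rfl⟩]
    simp only [map_add, map_sum, map_mul, map_sub, map_smul, map_one, Pi.add_apply,
      Finset.sum_apply, Pi.mul_apply, Pi.sub_apply, Pi.smul_apply, Pi.one_apply, hG,
      val_coord_even, Algebra.algebraMap_eq_smul_one]
  have hm : ∀ j, c.coord hW (Sum.inl j) - c.e x₀ j • (1 : A.Sec W) ∈ A.grading W 0 := fun j =>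
    Submodule.sub_mem _ (c.coord_mem hW (Sum.inl j))
      (Submodule.smul_mem _ _ SetLike.GradedOne.one_mem)
  rw [hsum, map_add, map_smul, hE.map_one, smul_zero, zero_add, map_sum, map_sum, map_zero,
    Finset.sum_apply]
  refine Finset.sum_eq_zero fun j _ => ?_
  rw [hE.leibniz _ (hm j), map_sub, map_smul, hE.map_one, hx]
  simp [val_coord_even, Algebra.algebraMap_eq_smul_one]

/-- Every section is a finite sum of scalar functions times Grassmann constants, both already killed
by `E`. -/
theorem superDer_eq_zero : E = 0 := by
  ext f
  let b := (Pi.basisFun ℝ (Fin m)).ExteriorAlgebra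
  choose s hs using fun i => c.exists_scalar hW (c.read_smooth hW f (b.coord i))
  choose t ht using fun i => c.exists_const hW (b i)
  have hsum : f = ∑ i, s i * t i := c.val_ext hW fun x => by
    rw [map_sum, Finset.sum_apply]
    simp only [map_mul, Pi.mul_apply, hs, ht, c.read_apply hW, ← Algebra.smul_def,
      Module.Basis.coord_apply]
    exact (b.sum_repr _).symm
  have hm : ∀ i, s i ∈ A.grading W 0 := fun i => by
    rw [c.val_parity W hW]
    intro x
    rw [hs]
    exact SetLike.algebraMap_mem_graded _ _
  rw [hsum, map_sum]
  refine Finset.sum_eq_zero fun i _ => ?_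
  rw [hE.leibniz _ (hm i), c.superDer_scalar_eq_zero hW hE hx (c.read_smooth hW f _) (hs i),
    c.superDer_const_eq_zero hW hE hx _ (ht i)]
  simp

end

/-- The coordinates of a chart, on an open subset of its domain. -/
noncomputable def coordSystem : CoordSystem (A.grading W) n m where
  x := c.coord hW
  d := c.pderivLin hW
  x_mem := c.coord_mem hW
  d_der := c.isSuperDer_pderivLin hW
  d_x := c.pderivLin_coord hW
  der_ext hE hx := c.superDer_eq_zero hW hE hx

end Chart

end SuperSheaf

/-! ### Existence and uniqueness of the Laplacian in one coordinate system -/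

section Algebra

variable {R : Type*} [Ring R] [Algebra ℝ R] {𝒜 : ZMod 2 → Submodule ℝ R} [GradedAlgebra 𝒜]
  {n m : ℕ}

theorem even_central (hc : IsSupercomm 𝒜) {f : R} (hf : f ∈ 𝒜 0) (g : R) : f * g = g * f :=
  LinearMap.congr_fun (f := LinearMap.mulLeft ℝ f) (g := LinearMap.mulRight ℝ f)
    (linearMap_eq_of_homogeneous (𝒜 := 𝒜) fun _ _ hg => even_mul_comm hc hf hg) g

theorem mem_of_decompose_eq_zero {p : ZMod 2} {f : R}
    (h : ∀ q, q ≠ p → (DirectSum.decompose 𝒜 f q : R) = 0) : f ∈ 𝒜 p := by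
  classical
  rw [← DirectSum.sum_support_decompose 𝒜 f]
  refine Submodule.sum_mem _ fun q _ => ?_
  by_cases hq : q = p
  · subst hq; exact SetLike.coe_mem _
  · rw [h q hq]; exact Submodule.zero_mem _

variable {C : CoordSystem 𝒜 n m} {B : R →ₗ[ℝ] R →ₗ[ℝ] R} {ρ : R}

theorem IsLaplacian.unique {D D' : R →ₗ[ℝ] R} (hρ : IsUnit ρ) (hD : IsLaplacian C B ρ D)
    (hD' : IsLaplacian C B ρ D') : D = D' :=
  linearMap_eq_of_homogeneous (𝒜 := 𝒜) fun p f hf =>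
    hρ.mul_right_cancel ((hD p f hf).symm.trans (hD' p f hf))

theorem exists_isLaplacian (C : CoordSystem 𝒜 n m) (B : R →ₗ[ℝ] R →ₗ[ℝ] R) (hρ : IsUnit ρ) :
    ∃ D, IsLaplacian C B ρ D := by
  obtain ⟨r, rfl⟩ := hρ
  -- The divergence formula involves the parity, so it is applied to each homogeneous component and
  -- the results are added.
  refine ⟨{ toFun := fun f => ∑ p, C.lie (p + 1) r
              (sgn (p + 1) • B (DirectSum.decompose 𝒜 f p)) * (r⁻¹ : Rˣ)
            map_add' := fun f g => ?_
            map_smul' := fun s f => ?_ }, fun p f hf => ?_⟩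
  · simp only [DirectSum.decompose_add, DirectSum.add_apply, Submodule.coe_add, map_add, smul_add,
      C.lie_add, add_mul, Finset.sum_add_distrib]
  · simp only [DirectSum.decompose_smul, DirectSum.smul_apply, Submodule.coe_smul, map_smul,
      C.lie_smul, smul_mul_assoc, Finset.smul_sum, RingHom.id_apply]
    exact Finset.sum_congr rfl fun p _ => by rw [smul_comm]
  · simp only [LinearMap.coe_mk, AddHom.coe_mk]
    rw [Finset.sum_eq_single p]
    · rw [DirectSum.decompose_of_mem_same 𝒜 hf, mul_assoc, r.inv_mul, mul_one]
    · intro q _ hq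
      rw [DirectSum.decompose_of_mem_ne 𝒜 hf hq.symm, map_zero, C.lie_smul]
      simp [CoordSystem.lie]
    · simp

end Algebra

/-! ### Berezinians under ring homomorphisms -/

section Berezinian

open Matrix

theorem map_leibnizDet {R S : Type*} [Ring R] [Ring S] (φ : R →+* S) {k : ℕ}
    (B : Matrix (Fin k) (Fin k) R) : φ (leibnizDet B) = leibnizDet (B.map φ) := by
  rw [leibnizDet, leibnizDet, map_sum]
  refine Finset.sum_congr rfl fun s _ => ?_
  rw [Units.smul_def, Units.smul_def, map_zsmul, map_list_prod, List.map_ofFn]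
  rfl

theorem map_ringInverse {R S : Type*} [Ring R] [Ring S] (φ : R →+* S) {u : R} (hu : IsUnit u) :
    φ (Ring.inverse u) = Ring.inverse (φ u) := by
  obtain ⟨u, rfl⟩ := hu
  rw [Ring.inverse_unit]
  exact (Ring.inverse_unit (Units.map (φ : R →* S) u)).symm

/-- `Ring.inverse` takes the value `0` off the units, so it commutes with a homomorphism only where
the argument is known to be invertible. -/
theorem map_berezinian {R S : Type*} [Ring R] [Ring S] (φ : R →+* S) {n m : ℕ}
    {J : Matrix (Fin n ⊕ Fin m) (Fin n ⊕ Fin m) R} (hJ : IsUnit J.toBlocks₂₂)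
    (hdet : IsUnit (leibnizDet J.toBlocks₂₂)) :
    φ (berezinian J) = berezinian (J.map φ) := by
  have h := map_ringInverse (φ.mapMatrix (m := Fin m)) hJ
  simp only [RingHom.mapMatrix_apply] at h
  rw [berezinian, berezinian, map_mul, map_leibnizDet, map_ringInverse φ hdet, map_leibnizDet,
    Matrix.map_sub φ (map_sub φ), Matrix.map_mul, Matrix.map_mul, h]
  rfl

variable {R : Type*} [Ring R] [Algebra ℝ R] {𝒜 : ZMod 2 → Submodule ℝ R} [GradedAlgebra 𝒜]
  {n m : ℕ}

theorem isUnit_toBlocks₂₂ (hc : IsSupercomm 𝒜)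
    {J K : Matrix (SuperSheaf.Idx n m) (SuperSheaf.Idx n m) R}
    (hJ : IsHomMatrix 𝒜 0 J) (hK : IsHomMatrix 𝒜 0 K) (hJK : J * K = 1) :
    IsUnit J.toBlocks₂₂ ∧ IsUnit (leibnizDet J.toBlocks₂₂) := by
  have : Fact (IsSupercomm 𝒜) := ⟨hc⟩
  obtain ⟨S, T, D, E, -, hDE, hD, -, -⟩ := exists_block_decomposition hJ hK hJK
  rw [hD, ← RingHom.mapMatrix_apply, leibnizDet_evenVal]
  have hu : IsUnit D := ⟨⟨D, E, hDE, mul_eq_one_comm.1 hDE⟩, rfl⟩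
  exact ⟨hu.map _, ((isUnit_iff_isUnit_det D).1 hu).map _⟩

end Berezinian

/-! ### Compatibility with restriction -/

namespace SuperSheaf

variable {X : TopCat.{u}} (A : SuperSheaf X)

theorem res_decompose {U V : Opens X} (h : V ≤ U) (f : A.Sec U) (p : ZMod 2) :
    A.res h (DirectSum.decompose (A.grading U) f p : A.Sec U) =
      DirectSum.decompose (A.grading V) (A.res h f) p := by
  induction f using DirectSum.Decomposition.inductionOn (A.grading U) with
  | zero => simp
  | @homogeneous q f =>
    have hf := A.res_mem h f.2
    by_cases hq : q = p
    · subst hq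
      rw [DirectSum.decompose_of_mem_same _ f.2, DirectSum.decompose_of_mem_same _ hf]
    · rw [DirectSum.decompose_of_mem_ne _ f.2 hq, DirectSum.decompose_of_mem_ne _ hf hq, map_zero]
  | add f g hf hg =>
    simp only [DirectSum.decompose_add, DirectSum.add_apply, Submodule.coe_add, map_add, hf, hg]

namespace Chart

variable {A} {n m : ℕ} (c : A.Chart n m) {W V : Opens X} (hW : W ≤ c.dom) (h : V ≤ W)

theorem res_coord (a : Idx n m) :
    A.res h (c.coord hW a) = c.coord (h.trans hW) a := by
  refine c.val_ext (h.trans hW) fun x => ?_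
  rw [c.val_res h hW]
  cases a with
  | inl j => rw [val_coord_even, val_coord_even]
  | inr k => rw [val_coord_odd, val_coord_odd]

theorem res_pderiv (a : Idx n m) (f : A.Sec W) :
    A.res h (c.pderiv hW a f) = c.pderiv (h.trans hW) a (A.res h f) := by
  refine c.val_ext (h.trans hW) fun x => ?_
  rw [c.val_res h hW]
  cases a with
  | inl j =>
    refine grassmann_ext fun l => ?_
    rw [val_pderiv_even, val_pderiv_even]
    have he : (fun y => l (c.read hW f y)) =ᶠ[nhds (c.e x)]
        fun y => l (c.read (h.trans hW) (A.res h f) y) := by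
      filter_upwards [(c.isOpen_image (h.trans hW)).mem_nhds ⟨x, x.2, rfl⟩]
      rintro _ ⟨z, hz, rfl⟩
      rw [c.read_apply (h.trans hW) _ ⟨z, hz⟩, c.read_apply hW _ ⟨z, h hz⟩, c.val_res h hW]
    rw [he.fderiv_eq]
  | inr k => rw [val_pderiv_odd, val_pderiv_odd, c.val_res h hW]

theorem res_lie (p : ZMod 2) (ρ : A.Sec W) {Y : A.Sec W →ₗ[ℝ] A.Sec W}
    {Z : A.Sec V →ₗ[ℝ] A.Sec V} (hYZ : ∀ f, A.res h (Y f) = Z (A.res h f)) :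
    A.res h ((c.coordSystem hW).lie p ρ Y) =
      (c.coordSystem (h.trans hW)).lie p (A.res h ρ) Z := by
  unfold CoordSystem.lie
  rw [map_sum]
  refine Finset.sum_congr rfl fun a _ => ?_
  rw [map_smul]
  congr 1
  change A.res h (c.pderiv hW a (ρ * Y (c.coord hW a))) =
    c.pderiv (h.trans hW) a (A.res h ρ * Z (c.coord (h.trans hW) a))
  rw [res_pderiv, map_mul, hYZ, res_coord]

end Chart

end SuperSheaf

/-! ### Gluing the local Laplacians -/

namespace Supermanifold

open SuperSheaf

variable {n m : ℕ} {M : Supermanifold.{u} n m}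

theorem isOddBracket (P : M.OddPoisson) (U : Opens M.space) :
    IsOddBracket (M.parity U) (P.bracket U) :=
  ⟨P.bracket_mem U, P.bracket_symm U, P.bracket_mul U, P.bracket_jacobi U⟩

theorem le_iSup_inf_dom (U : Opens M.space) : U ≤ ⨆ c : M.Chart, U ⊓ c.dom := fun x hx => by
  obtain ⟨c, hc⟩ := M.exists_chart x
  exact Opens.mem_iSup.2 ⟨c, hx, hc⟩

theorem ext_of_charts {U : Opens M.space} {f g : M.Fn U}
    (h : ∀ c : M.Chart, M.res (inf_le_left : U ⊓ c.dom ≤ U) f = M.res inf_le_left g) : f = g :=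
  M.structureSheaf.sheaf.eq_of_locally_eq' (fun c : M.Chart => U ⊓ c.dom) U
    (fun _ => homOfLE inf_le_left) (le_iSup_inf_dom U) f g h

theorem mem_parity_of_charts {U : Opens M.space} {p : ZMod 2} {f : M.Fn U}
    (h : ∀ c : M.Chart, M.res (inf_le_left : U ⊓ c.dom ≤ U) f ∈ M.parity (U ⊓ c.dom) p) :
    f ∈ M.parity U p := by
  refine mem_of_decompose_eq_zero fun q hq => ext_of_charts fun c => ?_
  rw [map_zero, res_decompose, DirectSum.decompose_of_mem_ne _ (h c) hq.symm]

variable (P : M.OddPoisson) (ρ : M.VolumeForm)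

/-- The coefficient of a volume form on an open subset of a chart. -/
def VolumeForm.coeffOn (c : M.Chart) {W : Opens M.space} (hW : W ≤ c.dom) : M.Fn W :=
  M.res hW (ρ.coeff c)

theorem VolumeForm.coeffOn_even (c : M.Chart) {W : Opens M.space} (hW : W ≤ c.dom) :
    ρ.coeffOn c hW ∈ M.parity W 0 := res_mem _ hW (ρ.even c)

theorem VolumeForm.isUnit_coeffOn (c : M.Chart) {W : Opens M.space} (hW : W ≤ c.dom) :
    IsUnit (ρ.coeffOn c hW) := (ρ.isUnit c).map _

theorem VolumeForm.res_coeffOn (c : M.Chart) {W V : Opens M.space} (hW : W ≤ c.dom) (h : V ≤ W) :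
    M.res h (ρ.coeffOn c hW) = ρ.coeffOn c (h.trans hW) := res_res _ hW h _

/-- The transition law is given on the full overlap of two charts. Coordinates and partial
derivatives restrict, and the inverses in the Berezinian exist already on the overlap, so the law
passes to every smaller `W`. -/
theorem VolumeForm.coeffOn_transition (c d : M.Chart) {W : Opens M.space} (hc : W ≤ c.dom)
    (hd : W ≤ d.dom) :
    ρ.coeffOn c hc =
      berezinian ((c.coordSystem hc).jac (d.coordSystem hd)) * ρ.coeffOn d hd := by
  have hs := isSupercomm M.structureSheaf (c.dom ⊓ d.dom)
  let C := c.coordSystem (inf_le_left : c.dom ⊓ d.dom ≤ c.dom)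
  let C' := d.coordSystem (inf_le_right : c.dom ⊓ d.dom ≤ d.dom)
  obtain ⟨h1, h2⟩ := isUnit_toBlocks₂₂ hs (C.isHomMatrix_jac C') (C'.isHomMatrix_jac C)
    (C.jac_mul_jac C' hs)
  have hW : W ≤ c.dom ⊓ d.dom := le_inf hc hd
  have h := congrArg (M.res hW) (ρ.transition c d)
  have hber : M.res hW (berezinian (jacobian c d)) =
      berezinian ((c.coordSystem hc).jac (d.coordSystem hd)) := by
    refine (map_berezinian (M.res hW : M.Fn (c.dom ⊓ d.dom) →+* M.Fn W) h1 h2).trans ?_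
    congr 1
    ext a b
    exact (c.res_pderiv _ hW a _).trans (congrArg (c.pderiv hc a) (d.res_coord _ hW b))
  rw [map_mul, hber, res_res, res_res] at h
  exact h

/-- The odd Laplacian of a Poisson bracket on an open subset of a chart. -/
def IsLocalLaplacian (c : M.Chart) {W : Opens M.space} (hW : W ≤ c.dom)
    (D : M.Fn W →ₗ[ℝ] M.Fn W) : Prop :=
  IsLaplacian (c.coordSystem hW) (P.bracket W) (ρ.coeffOn c hW) D

variable {P ρ}

/-- Passing to another chart multiplies both the Lie derivative coefficient and the density by the
same Berezinian, which is even and hence central. -/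
theorem IsLocalLaplacian.change_chart {c d : M.Chart} {W : Opens M.space} (hc : W ≤ c.dom)
    {hd : W ≤ d.dom} {D : M.Fn W →ₗ[ℝ] M.Fn W} (hD : IsLocalLaplacian P ρ d hd D) :
    IsLocalLaplacian P ρ c hc D := by
  intro p f hf
  have hs := isSupercomm M.structureSheaf W
  rw [ρ.coeffOn_transition c d hc hd, (c.coordSystem hc).lie_berezinian_mul (d.coordSystem hd) hs
    (((isOddBracket P W).isSuperDer hf).smul _) (ρ.coeffOn_even d hd), hD p f hf, ← mul_assoc,
    even_central hs ((c.coordSystem hc).berezinian_jac_mem (d.coordSystem hd) hs), mul_assoc]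

/-- On homogeneous functions both sides times the density equal the restricted divergence
expression, and the density is a unit. -/
theorem IsLocalLaplacian.res_apply {c : M.Chart} {W V : Opens M.space} {hW : W ≤ c.dom}
    (h : V ≤ W) {D : M.Fn W →ₗ[ℝ] M.Fn W} (hD : IsLocalLaplacian P ρ c hW D)
    {D' : M.Fn V →ₗ[ℝ] M.Fn V} (hD' : IsLocalLaplacian P ρ c (h.trans hW) D') (f : M.Fn W) :
    M.res h (D f) = D' (M.res h f) := by
  refine LinearMap.congr_fun (f := (M.res h).toLinearMap ∘ₗ D)
    (g := D' ∘ₗ (M.res h).toLinearMap)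
    (linearMap_eq_of_homogeneous (𝒜 := M.parity W) fun p f hf => ?_) f
  refine (ρ.isUnit_coeffOn c (h.trans hW)).mul_right_cancel ?_
  refine Eq.trans ?_ (hD' p (M.res h f) (res_mem _ h hf))
  have h1 := congrArg (M.res h) (hD p f hf)
  rw [map_mul, ρ.res_coeffOn] at h1
  refine h1.symm.trans ((c.res_lie hW h _ _
    (Z := sgn (p + 1) • P.bracket V (M.res h f)) fun g => ?_).trans ?_)
  · rw [LinearMap.smul_apply, LinearMap.smul_apply, map_smul, P.bracket_res]
  · rw [ρ.res_coeffOn]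

theorem exists_isLocalLaplacian (P : M.OddPoisson) (ρ : M.VolumeForm) (c : M.Chart)
    {W : Opens M.space} (hW : W ≤ c.dom) : ∃ D, IsLocalLaplacian P ρ c hW D :=
  exists_isLaplacian _ _ (ρ.isUnit_coeffOn c hW)

theorem IsLocalLaplacian.unique {c : M.Chart} {W : Opens M.space} {hW : W ≤ c.dom}
    {D D' : M.Fn W →ₗ[ℝ] M.Fn W} (hD : IsLocalLaplacian P ρ c hW D)
    (hD' : IsLocalLaplacian P ρ c hW D') : D = D' :=
  IsLaplacian.unique (ρ.isUnit_coeffOn c hW) hD hD'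

variable (P ρ) in
/-- The odd Laplacian on an open subset of a chart. -/
noncomputable def localLaplacian (c : M.Chart) {W : Opens M.space} (hW : W ≤ c.dom) :
    M.Fn W →ₗ[ℝ] M.Fn W :=
  (exists_isLocalLaplacian P ρ c hW).choose

theorem isLocalLaplacian_localLaplacian (c : M.Chart) {W : Opens M.space} (hW : W ≤ c.dom) :
    IsLocalLaplacian P ρ c hW (localLaplacian P ρ c hW) :=
  (exists_isLocalLaplacian P ρ c hW).choose_spec

/-- On overlaps the restrictions of two local Laplacians satisfy the same defining property after a
change of chart, so uniqueness makes them equal and the sheaf axiom applies. -/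
theorem exists_glued_laplacian (P : M.OddPoisson) (ρ : M.VolumeForm) (U : Opens M.space)
    (f : M.Fn U) : ∃ g : M.Fn U, ∀ c : M.Chart, M.res (inf_le_left : U ⊓ c.dom ≤ U) g =
      localLaplacian P ρ c inf_le_right (M.res inf_le_left f) := by
  refine (M.structureSheaf.sheaf.existsUnique_gluing' (fun c : M.Chart => U ⊓ c.dom) U
    (fun _ => homOfLE inf_le_left) (le_iSup_inf_dom U)
    (fun c => localLaplacian P ρ c inf_le_right (M.res inf_le_left f)) fun c d => ?_).exists
  have hc : (U ⊓ c.dom) ⊓ (U ⊓ d.dom) ≤ c.dom := inf_le_left.trans inf_le_right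
  have hd : (U ⊓ c.dom) ⊓ (U ⊓ d.dom) ≤ d.dom := inf_le_right.trans inf_le_right
  change M.res (inf_le_left : (U ⊓ c.dom) ⊓ (U ⊓ d.dom) ≤ U ⊓ c.dom) _ =
    M.res (inf_le_right : (U ⊓ c.dom) ⊓ (U ⊓ d.dom) ≤ U ⊓ d.dom) _
  rw [(isLocalLaplacian_localLaplacian c _).res_apply inf_le_left
      (isLocalLaplacian_localLaplacian c hc),
    (isLocalLaplacian_localLaplacian d _).res_apply inf_le_right
      (isLocalLaplacian_localLaplacian d hd),
    (isLocalLaplacian_localLaplacian (P := P) (ρ := ρ) c hc).unique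
      ((isLocalLaplacian_localLaplacian d hd).change_chart hc), res_res, res_res]

/-- Replaces the divergence condition, stated for homogeneous functions only, by an explicit formula
in each chart for all functions. Uniqueness and every identity for `Δ²` are then local. -/
theorem isOddLaplacian_iff {D : M.FnOperator} :
    IsOddLaplacian P ρ D ↔ ∀ (U : Opens M.space) (f : M.Fn U) (c : M.Chart),
      M.res (inf_le_left : U ⊓ c.dom ≤ U) (D U f) =
        localLaplacian P ρ c inf_le_right (M.res inf_le_left f) := by
  have key : ∀ (U : Opens M.space) (p : ZMod 2) (f : M.Fn U) (hf : f ∈ M.parity U p)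
      (c : M.Chart), ρ.lieCoeff (P.hamiltonian f hf) c =
        localLaplacian P ρ c inf_le_right (M.res inf_le_left f) *
          M.res (inf_le_right : U ⊓ c.dom ≤ c.dom) (ρ.coeff c) := fun U p f hf c =>
    isLocalLaplacian_localLaplacian c inf_le_right p _ (res_mem _ inf_le_left hf)
  constructor
  · intro hD U f c
    refine LinearMap.congr_fun (f := (M.res inf_le_left).toLinearMap ∘ₗ D U)
      (g := localLaplacian P ρ c inf_le_right ∘ₗ (M.res inf_le_left).toLinearMap)
      (linearMap_eq_of_homogeneous (𝒜 := M.parity U) fun p f hf => ?_) f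
    exact (ρ.isUnit_coeffOn c inf_le_right).mul_right_cancel
      ((hD U p f hf c).symm.trans (key U p f hf c))
  · intro hD U p f hf c
    rw [key, hD]

theorem existsUnique_isOddLaplacian (P : M.OddPoisson) (ρ : M.VolumeForm) :
    ∃! D : M.FnOperator, IsOddLaplacian P ρ D := by
  choose Δ hΔ using exists_glued_laplacian P ρ
  refine ⟨fun U =>
    { toFun := Δ U
      map_add' := fun f g => ext_of_charts fun c => by simp only [map_add, hΔ]
      map_smul' := fun r f => ext_of_charts fun c => by
        simp only [map_smul, hΔ, RingHom.id_apply] }, isOddLaplacian_iff.2 hΔ, fun D hD => ?_⟩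
  funext U
  ext f
  exact ext_of_charts fun c => (isOddLaplacian_iff.1 hD U f c).trans (hΔ U f c).symm

theorem isOddLaplacian_oddLaplacian (P : M.OddPoisson) (ρ : M.VolumeForm) :
    IsOddLaplacian P ρ (oddLaplacian P ρ) :=
  Classical.epsilon_spec (existsUnique_isOddLaplacian P ρ).exists

/-- The square of the odd Laplacian as an even vector field. -/
noncomputable def oddLaplacianSq (P : M.OddPoisson) (ρ : M.VolumeForm) : M.VectorField ⊤ 0 :=
  have hΔ := isOddLaplacian_iff.1 (isOddLaplacian_oddLaplacian P ρ)
  have hl : ∀ (U : Opens M.space) (c : M.Chart), IsLaplacian (c.coordSystem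
      (inf_le_right : U ⊓ c.dom ≤ c.dom)) (P.bracket _) _ (localLaplacian P ρ c inf_le_right) :=
    fun U c => isLocalLaplacian_localLaplacian c inf_le_right
  { toFun := fun W _ => oddLaplacian P ρ W ∘ₗ oddLaplacian P ρ W
    map_mem := fun W _ {q f} hf => mem_parity_of_charts fun c => by
      simp only [LinearMap.comp_apply, hΔ]
      have h := (hl W c).mem (isOddBracket P _) (ρ.coeffOn_even c _) (ρ.isUnit_coeffOn c _)
        ((hl W c).mem (isOddBracket P _) (ρ.coeffOn_even c _) (ρ.isUnit_coeffOn c _)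
          (res_mem _ inf_le_left hf))
      rwa [(by decide : ∀ q : ZMod 2, q + 1 + 1 = 0 + q)] at h
    map_res := fun {W V} _ h f => by
      -- The defining property imposes no compatibility with restriction; it is a consequence of
      -- locality and of `IsLocalLaplacian.res_apply`.
      have hres : ∀ f, oddLaplacian P ρ V (M.res h f) = M.res h (oddLaplacian P ρ W f) := by
        intro f
        refine ext_of_charts fun c => ?_
        have hVW : V ⊓ c.dom ≤ W ⊓ c.dom := inf_le_inf_right _ h
        rw [hΔ, res_res, res_res, ← res_res _ (inf_le_left : W ⊓ c.dom ≤ W) hVW,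
          ← res_res _ (inf_le_left : W ⊓ c.dom ≤ W) hVW, hΔ,
          (isLocalLaplacian_localLaplacian c _).res_apply hVW
            (isLocalLaplacian_localLaplacian c _)]
      simp only [LinearMap.comp_apply, hres]
    leibniz := fun W _ {q f} g hf => ext_of_charts fun c => by
      simp only [LinearMap.comp_apply, zero_mul, sgn_zero, one_smul, map_add, map_mul, hΔ]
      exact (hl W c).sq_map_mul (isSupercomm _ _) (isOddBracket P _) (ρ.coeffOn_even c _)
        (ρ.isUnit_coeffOn c _) (res_mem _ inf_le_left hf) _ }

theorem isPoisson_oddLaplacianSq (P : M.OddPoisson) (ρ : M.VolumeForm) :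
    (oddLaplacianSq P ρ).IsPoisson P := by
  intro U q f g hf
  have hΔ := isOddLaplacian_iff.1 (isOddLaplacian_oddLaplacian P ρ)
  refine ext_of_charts fun c => ?_
  simp only [oddLaplacianSq, LinearMap.comp_apply, zero_mul, sgn_zero, one_smul, map_add, hΔ,
    ← P.bracket_res]
  exact IsLaplacian.sq_map_bracket (isLocalLaplacian_localLaplacian c inf_le_right)
    (isSupercomm _ _) (isOddBracket P _) (ρ.coeffOn_even c _)
    (ρ.isUnit_coeffOn c _) (res_mem _ inf_le_left hf) _

end Supermanifold

end SuperGeometry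

theorem mainTheorem6 {n m : ℕ} (M : SuperGeometry.Supermanifold.{u} n m)
    (P : M.OddPoisson) (ρ : M.VolumeForm) :
    (∃! D : M.FnOperator, SuperGeometry.Supermanifold.IsOddLaplacian P ρ D) ∧
    ∃ Y : M.VectorField ⊤ 0,
      (∀ (U : TopologicalSpace.Opens M.space) (f : M.Fn U),
        SuperGeometry.Supermanifold.oddLaplacian P ρ U
          (SuperGeometry.Supermanifold.oddLaplacian P ρ U f) = Y.toFun U le_top f) ∧
      Y.IsPoisson P :=
  ⟨SuperGeometry.Supermanifold.existsUnique_isOddLaplacian P ρ,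
    SuperGeometry.Supermanifold.oddLaplacianSq P ρ, fun _ _ => rfl,
    SuperGeometry.Supermanifold.isPoisson_oddLaplacianSq P ρ⟩
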